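/- Theorem. Let $L\subset\mathbb C$ be a lattice (a discrete subgroup of rank two spanning $\mathbb C$ over $\mathbb R$). A vector $v\in L$ is primitive if $v=nw$ with $w\in L$, $n\in\mathbb Z$ forces $n=\pm1$. A positive completion of $v$ is a vector $v'$ such that $\{v,v'\}$ is a $\mathbb Z$-basis of $L$ with $\operatorname{Im}(v'/v)>0$. The skewness of such a pair is $\operatorname{sk}(v,v')=\langle v',v\rangle/|v|^2$, where $\langle\cdot,\cdot\rangle$ is the Euclidean inner product on $\mathbb C=\mathbb R^2$. Every primitive vector $v$ of $L$ has a positive completion $v'$; for every such $v'$ one has $\operatorname{sk}(v,v')=\operatorname{Re}(v'/v)$, and the class of $\operatorname{sk}(v,v')$ modulo one does not depend on the choice of $v'$. Let $\operatorname{sk}(v)\in(-1/2,1/2]$ denote the representative of this class (the least skewness of $v$). As $v$ ranges over all primitive vectors of $L$, ordered by norm, the least skewness $\operatorname{sk}(v)$ is uniformly distributed modulo one. Explicitly, let $L_{prim}(T)$ be the finite set of primitive vectors $v$ of $L$ with $|v|\le T$. Then for all real $\alpha,\beta$ with $-1/2\le\alpha\le\beta\le1/2$, $$\frac{\#\{v\in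 L_{prim}(T):\ \alpha<\operatorname{sk}(v)<\beta\}}{\#L_{prim}(T)}\longrightarrow\beta-\alpha\qquad(T\to\infty).$$ -/

import Mathlib

open Filter Topology

noncomputable section

/-- `v` is a primitive vector of `L`: it lies in `L` and is an integer multiple of another vector
of `L` only in the trivial way. (In particular `v ≠ 0`, since `0 = 2 • 0`.) -/
def IsPrimitiveVector (L : Submodule ℤ ℂ) (v : ℂ) : Prop :=
  v ∈ L ∧ ∀ w ∈ L, ∀ n : ℤ, v = n • w → n = 1 ∨ n = -1

/-- `L_prim(T)`: the primitive vectors of `L` of norm at most `T`. -/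
def primitiveVectors (L : Submodule ℤ ℂ) (T : ℝ) : Set ℂ :=
  {v | IsPrimitiveVector L v ∧ ‖v‖ ≤ T}

/-- The set `L_prim(T)` is finite, so that `Set.ncard` is its true cardinality. -/
theorem primitiveVectors_finite (L : Submodule ℤ ℂ) [DiscreteTopology L] (T : ℝ) :
    (primitiveVectors L T).Finite := by
  have hc : IsClosed (L : Set ℂ) :=
    AddSubgroup.isClosed_of_discrete (H := L.toAddSubgroup)
  have hd : IsDiscrete (L : Set ℂ) := ⟨inferInstanceAs (DiscreteTopology L)⟩
  have := Metric.finite_isBounded_inter_isClosed hd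
    (Metric.isBounded_closedBall (x := (0 : ℂ)) (r := T)) hc
  refine this.subset ?_
  rintro v ⟨hv, hT⟩
  exact ⟨by simpa using hT, hv.1⟩

/-- `v'` is a positive completion of `v`: the pair `v, v'` is a `ℤ`-basis of `L` which is
positively oriented. -/
def IsPositiveCompletion (L : Submodule ℤ ℂ) (v v' : ℂ) : Prop :=
  LinearIndependent ℤ ![v, v'] ∧ Submodule.span ℤ {v, v'} = L ∧ 0 < (v' / v).im

/-- The skewness `⟨v', v⟩ / |v|²` of the parallelogram spanned by `v` and `v'`: the orthogonal
projection of `v'` to the line through `v` is this multiple of `v`. -/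
def skewness (v v' : ℂ) : ℝ :=
  inner ℝ v' v / ‖v‖ ^ 2

open Classical in
/-- The least skewness of `v`: the representative in `(-1/2, 1/2]` of the skewness modulo one of
a positive completion of `v` (junk value `0` if there is no such completion). -/
def leastSkewness (L : Submodule ℤ ℂ) (v : ℂ) : ℝ :=
  if h : ∃ v', IsPositiveCompletion L v v' then
    toIocMod (one_pos : (0 : ℝ) < 1) (-1 / 2) (skewness v h.choose)
  else 0

end

/-! By Weyl's criterion it is enough that, for every integer k ≠ 0, the sum of e(k sk(v)) over
primitive v with |v| ≤ T is o(T²), because there are at least c T² such v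
(`exists_sq_le_ncard_primitiveVectors`).

Fix a basis u, w and write v = A u + B w. A completion v' = C u + D w has AD − BC = s, where s = ±1
is the orientation of the basis, and v'/v = D/B − s u/(B v). So sk(v) is s A⁻¹/B modulo one, up to a
small error, with A⁻¹ the inverse modulo B. For fixed B the admissible A form an interval. Each full
period contributes a Ramanujan sum, at most k², and the incomplete period at most B. If ℓ is a
linear functional positive on u and w, then B ≤ ‖ℓ‖T/ℓ(w), and summing over B bounds the cone of u
and w by ‖ℓ‖²T²/ℓ(w)² + O(T log T) (`coneBound_expTwoPi`).

This is still of order T², but it beats the trivial ‖ℓ‖²T²/(ℓ(u)ℓ(w)) when ℓ(w) is much larger than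
ℓ(u). Changing the basis amplifies the gain. The mediant u + w splits a cone in two, and the weights
1/(ℓ(u)ℓ(w)) of the pieces add up exactly. After n splittings one piece is the cone of u and nu + w,
where the gain applies. Hence a constant R valid for all cones improves to (Rn + C/n)/(n + 1)
(`UniformConeBound.improve`). The best constant is then at most C/n for every n, so it is zero
(`uniformConeBound_zero`). -/

/-! ### Additive characters and Ramanujan sums. -/

/-- The additive character `x ↦ exp (2πix)` of the real line. -/
noncomputable def expTwoPi (x : ℝ) : ℂ := Complex.exp (((2 * Real.pi * x : ℝ) : ℂ) * Complex.I)

theorem norm_expTwoPi (x : ℝ) : ‖expTwoPi x‖ = 1 := Complex.norm_exp_ofReal_mul_I _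

theorem expTwoPi_add (x y : ℝ) : expTwoPi (x + y) = expTwoPi x * expTwoPi y := by
  unfold expTwoPi
  rw [← Complex.exp_add]
  push_cast
  ring_nf

theorem expTwoPi_intCast (n : ℤ) : expTwoPi n = 1 := by
  unfold expTwoPi
  rw [Complex.exp_eq_one_iff]
  exact ⟨n, by push_cast; ring⟩

theorem expTwoPi_add_intCast (x : ℝ) (n : ℤ) : expTwoPi (x + n) = expTwoPi x := by
  rw [expTwoPi_add, expTwoPi_intCast, mul_one]

theorem expTwoPi_eq_one_iff (x : ℝ) : expTwoPi x = 1 ↔ ∃ n : ℤ, x = n := by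
  constructor
  · intro h
    unfold expTwoPi at h
    rw [Complex.exp_eq_one_iff] at h
    obtain ⟨n, hn⟩ := h
    refine ⟨n, ?_⟩
    have hpi : (2 * Real.pi * Complex.I : ℂ) ≠ 0 := Complex.two_pi_I_ne_zero
    have : (x : ℂ) * (2 * Real.pi * Complex.I) = n * (2 * Real.pi * Complex.I) := by
      rw [← hn]; push_cast; ring
    exact_mod_cast mul_right_cancel₀ hpi this
  · rintro ⟨n, rfl⟩
    exact expTwoPi_intCast n

theorem norm_expTwoPi_sub_le (x y : ℝ) : ‖expTwoPi x - expTwoPi y‖ ≤ 2 * Real.pi * |x - y| := by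
  have h : expTwoPi x = expTwoPi y * expTwoPi (x - y) := by rw [← expTwoPi_add]; ring_nf
  have h2 : expTwoPi x - expTwoPi y = expTwoPi y * (expTwoPi (x - y) - 1) := by rw [h]; ring
  rw [h2, norm_mul, norm_expTwoPi, one_mul]
  have := Real.norm_exp_I_mul_ofReal_sub_one_le (x := 2 * Real.pi * (x - y))
  rw [mul_comm Complex.I] at this
  refine this.trans_eq ?_
  rw [Real.norm_eq_abs, abs_mul, abs_of_pos Real.two_pi_pos]

theorem fourier_coe_eq_expTwoPi (k : ℤ) (x : ℝ) :
    fourier k (x : UnitAddCircle) = expTwoPi (k * x) := by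
  rw [fourier_coe_apply]
  unfold expTwoPi
  push_cast
  ring_nf

/-- A full geometric sum of roots of unity vanishes unless all its terms are `1`. -/
theorem norm_sum_expTwoPi_le (k : ℤ) {n : ℕ} (hn : 0 < n) :
    ‖∑ j ∈ Finset.range n, expTwoPi (k * j / n)‖ ≤ if (n : ℤ) ∣ k then (n : ℝ) else 0 := by
  have hn' : (n : ℝ) ≠ 0 := by positivity
  split_ifs with h
  · refine (norm_sum_le _ _).trans ?_
    simp [norm_expTwoPi]
  · have hz : expTwoPi (k / n) ≠ 1 := by
      rw [Ne, expTwoPi_eq_one_iff]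
      rintro ⟨m, hm⟩
      refine h ⟨m, ?_⟩
      rw [div_eq_iff hn'] at hm
      have : (k : ℝ) = n * m := by rw [hm]; ring
      exact_mod_cast this
    have hpow : ∀ j : ℕ, expTwoPi (k * j / n) = expTwoPi (k / n) ^ j := by
      intro j
      induction j with
      | zero => simpa using expTwoPi_intCast 0
      | succ j ih =>
        rw [pow_succ, ← ih, ← expTwoPi_add]
        congr 1
        push_cast
        ring
    have hone : expTwoPi (k / n) ^ n = 1 := by
      rw [← hpow, mul_div_assoc, div_self hn', mul_one, expTwoPi_intCast]
    simp_rw [hpow]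
    rw [geom_sum_eq hz, hone, sub_self, zero_div, norm_zero]

/-- The divisors of B that divide a are those of gcd(a, B), so this is Möbius inversion; it detects
coprimality in the Ramanujan sum. -/
theorem sum_moebius_divisors_gcd (a : ℕ) {B : ℕ} (hB : 0 < B) :
    ∑ d ∈ B.divisors with d ∣ a, (ArithmeticFunction.moebius d : ℂ) =
      if a.Coprime B then 1 else 0 := by
  have h1 : B.divisors.filter (· ∣ a) = (a.gcd B).divisors := by
    ext d
    simp only [Finset.mem_filter, Nat.mem_divisors, Nat.dvd_gcd_iff]
    constructor
    · rintro ⟨⟨h1, h2⟩, h3⟩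
      exact ⟨⟨h3, h1⟩, (Nat.gcd_pos_of_pos_right _ hB).ne'⟩
    · rintro ⟨⟨h3, h1⟩, h2⟩
      exact ⟨⟨h1, hB.ne'⟩, h3⟩
  rw [h1]
  have h2 := congrArg (fun f : ArithmeticFunction ℂ => f (a.gcd B))
    (ArithmeticFunction.coe_zeta_mul_coe_moebius (R := ℂ))
  simp only [ArithmeticFunction.coe_zeta_mul_apply, ArithmeticFunction.one_apply,
    ArithmeticFunction.intCoe_apply] at h2
  rw [h2]

theorem sum_range_filter_dvd {B d : ℕ} (hd : d ∣ B) (hB : 0 < B) (f : ℕ → ℂ) :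
    ∑ a ∈ Finset.range B with d ∣ a, f a = ∑ j ∈ Finset.range (B / d), f (d * j) := by
  have hd0 : 0 < d := Nat.pos_of_dvd_of_pos hd hB
  symm
  refine Finset.sum_bij (fun j _ => d * j) ?_ ?_ ?_ ?_
  · intro j hj
    rw [Finset.mem_range, Nat.lt_div_iff_mul_lt_of_dvd hd0.ne' hd] at hj
    rw [Finset.mem_filter, Finset.mem_range]
    exact ⟨by rwa [mul_comm], dvd_mul_right _ _⟩
  · intro i _ j _ h
    exact Nat.eq_of_mul_eq_mul_left hd0 h
  · rintro b hb
    rw [Finset.mem_filter, Finset.mem_range] at hb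
    obtain ⟨hb, j, rfl⟩ := hb
    refine ⟨j, ?_, rfl⟩
    rw [Finset.mem_range, Nat.lt_div_iff_mul_lt_of_dvd hd0.ne' hd]
    rwa [mul_comm]
  · intros; rfl

/-- Ramanujan sums to a fixed nonzero frequency are bounded independently of the modulus. -/
theorem norm_ramanujanSum_le {k : ℤ} (hk : k ≠ 0) {B : ℕ} (hB : 0 < B) :
    ‖∑ a ∈ Finset.range B with a.Coprime B, expTwoPi (k * a / B)‖ ≤ (k : ℝ) ^ 2 := by
  have h1 : ∑ a ∈ Finset.range B with a.Coprime B, expTwoPi (k * a / B) =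
      ∑ d ∈ B.divisors, (ArithmeticFunction.moebius d : ℂ) *
        ∑ j ∈ Finset.range (B / d), expTwoPi (k * j / (B / d : ℕ)) := by
    calc _ = ∑ a ∈ Finset.range B, ∑ d ∈ B.divisors,
          if d ∣ a then (ArithmeticFunction.moebius d : ℂ) * expTwoPi (k * a / B) else 0 := by
          rw [Finset.sum_filter]
          refine Finset.sum_congr rfl fun a _ => ?_
          rw [← Finset.sum_filter, ← Finset.sum_mul, sum_moebius_divisors_gcd a hB]
          split_ifs <;> simp
      _ = _ := by
          rw [Finset.sum_comm]
          refine Finset.sum_congr rfl fun d hd => ?_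
          have hdB := Nat.dvd_of_mem_divisors hd
          have hd0 : (d : ℝ) ≠ 0 := by exact_mod_cast (Nat.pos_of_dvd_of_pos hdB hB).ne'
          rw [← Finset.sum_filter, sum_range_filter_dvd hdB hB, Finset.mul_sum]
          refine Finset.sum_congr rfl fun j _ => ?_
          congr 2
          rw [Nat.cast_div hdB hd0]
          push_cast
          field_simp
  rw [h1]
  have hka : (k.natAbs : ℝ) = |(k : ℝ)| := by rw [Nat.cast_natAbs, Int.cast_abs]
  calc _ ≤ ∑ d ∈ B.divisors, if ((B / d : ℕ) : ℤ) ∣ k then ((B / d : ℕ) : ℝ) else 0 := by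
        refine (norm_sum_le _ _).trans (Finset.sum_le_sum fun d hd => ?_)
        have hpos : 0 < B / d := Nat.div_pos (Nat.divisor_le hd) (Nat.pos_of_mem_divisors hd)
        rw [norm_mul]
        refine (mul_le_of_le_one_left (norm_nonneg _) ?_).trans (norm_sum_expTwoPi_le k hpos)
        rw [Complex.norm_intCast]
        exact_mod_cast ArithmeticFunction.abs_moebius_le_one
    -- The involution d ↦ B/d turns the condition into d ∣ k, so only divisors of k survive,
    -- whatever B is.
    _ = ∑ d ∈ B.divisors, if (d : ℤ) ∣ k then (d : ℝ) else 0 :=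
        Nat.sum_div_divisors B (fun d => if (d : ℤ) ∣ k then (d : ℝ) else 0)
    _ ≤ ∑ d ∈ k.natAbs.divisors, (d : ℝ) := by
        rw [← Finset.sum_filter]
        refine Finset.sum_le_sum_of_subset_of_nonneg ?_ (fun _ _ _ => Nat.cast_nonneg _)
        intro d hd
        rw [Finset.mem_filter] at hd
        rw [Nat.mem_divisors]
        exact ⟨Int.natCast_dvd.mp hd.2, Int.natAbs_ne_zero.mpr hk⟩
    _ ≤ ∑ d ∈ k.natAbs.divisors, (k.natAbs : ℝ) :=
        Finset.sum_le_sum fun d hd => by exact_mod_cast Nat.divisor_le hd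
    _ ≤ (k.natAbs : ℝ) * k.natAbs := by
        rw [Finset.sum_const, nsmul_eq_mul]
        gcongr
        exact Nat.card_divisors_le_self _
    _ = (k : ℝ) ^ 2 := by rw [hka, ← pow_two, sq_abs]

/-! ### Sums of modular inverse phases over intervals. -/

/-- The function `A ↦ e(k A⁻¹ / B)` on integers coprime to `B`, extended by zero. -/
noncomputable def invPhase (k : ℤ) (B A : ℕ) : ℂ :=
  if A.Coprime B then expTwoPi (k * ((A : ZMod B)⁻¹).val / B) else 0

theorem norm_invPhase_le (k : ℤ) (B A : ℕ) : ‖invPhase k B A‖ ≤ 1 := by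
  unfold invPhase
  split_ifs
  · rw [norm_expTwoPi]
  · simp

theorem invPhase_periodic (k : ℤ) (B : ℕ) : Function.Periodic (invPhase k B) B := by
  intro A
  simp [invPhase]

theorem coprime_val_inv {A B : ℕ} (hB : 0 < B) (h : A.Coprime B) :
    (((A : ZMod B)⁻¹).val).Coprime B ∧ ((((A : ZMod B)⁻¹).val : ZMod B))⁻¹ = A := by
  have : NeZero B := ⟨hB.ne'⟩
  have hu := ZMod.coe_mul_inv_eq_one A h
  have hunit : IsUnit ((A : ZMod B)⁻¹) := IsUnit.of_mul_eq_one_right _ hu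
  refine ⟨?_, ?_⟩
  · rw [← ZMod.isUnit_iff_coprime, ZMod.natCast_zmod_val]
    exact hunit
  · rw [ZMod.natCast_zmod_val]
    exact ZMod.inv_eq_of_mul_eq_one _ _ _ (by rw [mul_comm]; exact hu)

/-- Inversion is an involution of the residues coprime to B, so a full period is a reordered
Ramanujan sum. -/
theorem norm_sum_invPhase_le {k : ℤ} (hk : k ≠ 0) {B : ℕ} (hB : 0 < B) :
    ‖∑ a ∈ Finset.range B, invPhase k B a‖ ≤ (k : ℝ) ^ 2 := by
  have : NeZero B := ⟨hB.ne'⟩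
  refine le_trans (le_of_eq ?_) (norm_ramanujanSum_le hk hB)
  congr 1
  unfold invPhase
  rw [← Finset.sum_filter]
  refine Finset.sum_bij' (fun a _ => ((a : ZMod B)⁻¹).val) (fun a _ => ((a : ZMod B)⁻¹).val)
    ?_ ?_ ?_ ?_ ?_
  · intro a ha
    rw [Finset.mem_filter, Finset.mem_range] at ha ⊢
    exact ⟨ZMod.val_lt _, (coprime_val_inv hB ha.2).1⟩
  · intro a ha
    rw [Finset.mem_filter, Finset.mem_range] at ha ⊢
    exact ⟨ZMod.val_lt _, (coprime_val_inv hB ha.2).1⟩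
  · intro a ha
    rw [Finset.mem_filter, Finset.mem_range] at ha
    rw [(coprime_val_inv hB ha.2).2, ZMod.val_cast_of_lt ha.1]
  · intro a ha
    rw [Finset.mem_filter, Finset.mem_range] at ha
    rw [(coprime_val_inv hB ha.2).2, ZMod.val_cast_of_lt ha.1]
  · intros; rfl

theorem sum_range_add_of_periodic {g : ℕ → ℂ} {B : ℕ} (hg : Function.Periodic g B) (a : ℕ) :
    ∑ i ∈ Finset.range B, g (a + i) = ∑ i ∈ Finset.range B, g i := by
  induction a with
  | zero => simp
  | succ a ih =>
    rw [← ih]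
    have h1 := Finset.sum_range_succ (fun i => g (a + i)) B
    have h2 := Finset.sum_range_succ' (fun i => g (a + i)) B
    rw [h1, hg, add_zero] at h2
    rw [add_right_cancel h2]
    exact Finset.sum_congr rfl fun i _ => by congr 1; ring

/-- A sum of a periodic function over consecutive integers, in terms of the sum over a period. -/
theorem norm_sum_range_periodic_le {g : ℕ → ℂ} {B : ℕ} (hB : 0 < B) (hg : Function.Periodic g B)
    (hg1 : ∀ i, ‖g i‖ ≤ 1) {K : ℝ} (hK : ‖∑ i ∈ Finset.range B, g i‖ ≤ K) (n a : ℕ) :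
    ‖∑ i ∈ Finset.range n, g (a + i)‖ ≤ B + n / B * K := by
  have hB' : (B : ℝ) ≠ 0 := by positivity
  have hK0 : 0 ≤ K := (norm_nonneg _).trans hK
  induction n using Nat.strong_induction_on generalizing a with
  | _ n ih =>
    by_cases hn : n < B
    · have h1 : ‖∑ i ∈ Finset.range n, g (a + i)‖ ≤ n := by
        refine (norm_sum_le _ _).trans ((Finset.sum_le_sum fun i _ => hg1 _).trans ?_)
        simp
      have h2 : (n : ℝ) ≤ B := by exact_mod_cast hn.le
      have h3 : 0 ≤ (n : ℝ) / B * K := by positivity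
      linarith
    -- One full period is peeled off; it contributes at most `K`.
    · obtain ⟨m, rfl⟩ := Nat.exists_eq_add_of_le (not_lt.mp hn)
      rw [Finset.sum_range_add, sum_range_add_of_periodic hg]
      have h1 := ih m (by omega) (a + B)
      simp_rw [add_assoc] at h1
      refine (norm_add_le _ _).trans ((add_le_add hK h1).trans_eq ?_)
      push_cast
      field_simp
      ring

theorem norm_sum_ordConnected_periodic_le {g : ℕ → ℂ} {B : ℕ} (hB : 0 < B)
    (hg : Function.Periodic g B) (hg1 : ∀ i, ‖g i‖ ≤ 1) {K : ℝ}
    (hK : ‖∑ i ∈ Finset.range B, g i‖ ≤ K) (S : Finset ℕ) (hS : (S : Set ℕ).OrdConnected)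
    {X : ℝ} (hX : 0 ≤ X) (hSX : ∀ a ∈ S, 1 ≤ a ∧ (a : ℝ) ≤ X) :
    ‖∑ i ∈ S, g i‖ ≤ B + X / B * K := by
  have hK0 : 0 ≤ K := (norm_nonneg _).trans hK
  rcases S.eq_empty_or_nonempty with rfl | hne
  · simp only [Finset.sum_empty, norm_zero]
    positivity
  · set a := S.min' hne
    set b := S.max' hne
    have hab : a ≤ b := S.min'_le _ (S.max'_mem hne)
    have hSI : S = Finset.Ico a (b + 1) := by
      ext i
      rw [Finset.mem_Ico]
      constructor
      · intro hi
        exact ⟨S.min'_le _ hi, Nat.lt_succ_of_le (S.le_max' _ hi)⟩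
      · intro hi
        exact hS.out (S.min'_mem hne) (S.max'_mem hne) ⟨hi.1, Nat.le_of_lt_succ hi.2⟩
    rw [hSI, Finset.sum_Ico_eq_sum_range]
    refine (norm_sum_range_periodic_le hB hg hg1 hK _ _).trans ?_
    have h1 : 1 ≤ a := (hSX a (S.min'_mem hne)).1
    have h2 : (b : ℝ) ≤ X := (hSX b (S.max'_mem hne)).2
    have h3 : ((b + 1 - a : ℕ) : ℝ) ≤ X := by
      refine le_trans ?_ h2
      exact_mod_cast (by omega : b + 1 - a ≤ b)
    gcongr

/-! ### Lattice bases, primitive vectors and positive completions. -/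

/-- The determinant of two vectors of the plane. -/
def planeDet (u w : ℂ) : ℝ := u.re * w.im - u.im * w.re

/-- `u, w` is a `ℤ`-basis of `L` which is linearly independent over `ℝ`. -/
structure IsLatticeBasis (L : Submodule ℤ ℂ) (u w : ℂ) : Prop where
  det_ne_zero : planeDet u w ≠ 0
  span_eq : Submodule.span ℤ {u, w} = L

theorem planeDet_comb (u w : ℂ) (a b c d : ℤ) :
    planeDet (a * u + b * w) (c * u + d * w) = (a * d - b * c) * planeDet u w := by
  simp [planeDet]
  ring

theorem im_div_eq_planeDet (v v' : ℂ) : (v' / v).im = planeDet v v' / Complex.normSq v := by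
  rw [Complex.div_im, planeDet]
  ring

theorem eq_zero_of_planeDet_ne_zero {u w : ℂ} (h : planeDet u w ≠ 0) {x y : ℝ}
    (hxy : (x : ℂ) * u + y * w = 0) : x = 0 ∧ y = 0 := by
  have h1 := congrArg Complex.re hxy
  have h2 := congrArg Complex.im hxy
  simp at h1 h2
  unfold planeDet at h
  constructor
  · have : x * (u.re * w.im - u.im * w.re) = 0 := by linear_combination w.im * h1 - w.re * h2
    exact (mul_eq_zero.mp this).resolve_right h
  · have : y * (u.re * w.im - u.im * w.re) = 0 := by linear_combination u.re * h2 - u.im * h1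
    exact (mul_eq_zero.mp this).resolve_right h

theorem int_coords_unique {u w : ℂ} (h : planeDet u w ≠ 0) {a b a' b' : ℤ}
    (hab : (a : ℂ) * u + b * w = a' * u + b' * w) : a = a' ∧ b = b' := by
  have := eq_zero_of_planeDet_ne_zero h (x := ((a - a' : ℤ) : ℝ)) (y := ((b - b' : ℤ) : ℝ))
    (by push_cast; linear_combination hab)
  simp only [Int.cast_eq_zero] at this
  omega

namespace IsLatticeBasis

variable {L : Submodule ℤ ℂ} {u w : ℂ}

theorem mem_iff (h : IsLatticeBasis L u w) {v : ℂ} :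
    v ∈ L ↔ ∃ a b : ℤ, v = a * u + b * w := by
  rw [← h.span_eq, Submodule.mem_span_pair]
  simp only [zsmul_eq_mul]
  exact ⟨fun ⟨a, b, e⟩ => ⟨a, b, e.symm⟩, fun ⟨a, b, e⟩ => ⟨a, b, e.symm⟩⟩

theorem of_comb (h : IsLatticeBasis L u w) {a b c d : ℤ}
    (hdet : a * d - b * c = 1 ∨ a * d - b * c = -1) :
    IsLatticeBasis L (a * u + b * w) (c * u + d * w) := by
  have hne : a * d - b * c ≠ 0 := by omega
  refine ⟨?_, ?_⟩
  · rw [planeDet_comb]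
    exact mul_ne_zero (by exact_mod_cast hne) h.det_ne_zero
  -- `s` is the inverse of the determinant; Cramer's rule then recovers `u` and `w`.
  · obtain ⟨s, hs⟩ : ∃ s : ℤ, s * (a * d - b * c) = 1 := by
      rcases hdet with e | e <;> rw [e]
      · exact ⟨1, rfl⟩
      · exact ⟨-1, rfl⟩
    have hs' : (s : ℂ) * (a * d - b * c) = 1 := by exact_mod_cast hs
    apply le_antisymm
    · rw [Submodule.span_le]
      rintro x (rfl | rfl)
      · exact h.mem_iff.mpr ⟨a, b, rfl⟩
      · exact h.mem_iff.mpr ⟨c, d, rfl⟩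
    · rw [← h.span_eq, Submodule.span_le]
      rintro x (rfl | rfl)
      · refine Submodule.mem_span_pair.mpr ⟨s * d, -s * b, ?_⟩
        simp only [zsmul_eq_mul]
        push_cast
        linear_combination x * hs'
      · refine Submodule.mem_span_pair.mpr ⟨-s * c, s * a, ?_⟩
        simp only [zsmul_eq_mul]
        push_cast
        linear_combination x * hs'

theorem add_right (h : IsLatticeBasis L u w) : IsLatticeBasis L u (u + w) := by
  simpa using h.of_comb (a := 1) (b := 0) (c := 1) (d := 1) (by simp)

theorem add_left (h : IsLatticeBasis L u w) : IsLatticeBasis L (u + w) w := by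
  simpa using h.of_comb (a := 1) (b := 1) (c := 0) (d := 1) (by simp)

theorem symm (h : IsLatticeBasis L u w) : IsLatticeBasis L w u := by
  simpa using h.of_comb (a := 0) (b := 1) (c := 1) (d := 0) (by simp)

theorem neg_left (h : IsLatticeBasis L u w) : IsLatticeBasis L (-u) w := by
  simpa using h.of_comb (a := -1) (b := 0) (c := 0) (d := 1) (by simp)

theorem isPrimitiveVector_iff (h : IsLatticeBasis L u w) (a b : ℤ) :
    IsPrimitiveVector L (a * u + b * w) ↔ IsCoprime a b := by
  constructor
  · rintro ⟨-, hp⟩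
    rw [Int.isCoprime_iff_gcd_eq_one]
    obtain ⟨a', ha⟩ := Int.gcd_dvd_left a b
    obtain ⟨b', hb⟩ := Int.gcd_dvd_right a b
    have := hp (a' * u + b' * w) (h.mem_iff.mpr ⟨a', b', rfl⟩) (Int.gcd a b) (by
      rw [zsmul_eq_mul]
      have ha' : (a : ℂ) = ((Int.gcd a b : ℤ) : ℂ) * a' := by exact_mod_cast ha
      have hb' : (b : ℂ) = ((Int.gcd a b : ℤ) : ℂ) * b' := by exact_mod_cast hb
      linear_combination u * ha' + w * hb')
    omega
  · intro hc
    refine ⟨h.mem_iff.mpr ⟨a, b, rfl⟩, fun x hx n hn => ?_⟩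
    obtain ⟨c, d, rfl⟩ := h.mem_iff.mp hx
    rw [zsmul_eq_mul] at hn
    obtain ⟨h1, h2⟩ := int_coords_unique h.det_ne_zero (a := a) (b := b) (a' := n * c)
      (b' := n * d) (by push_cast; linear_combination hn)
    have : IsUnit n := hc.isUnit_of_dvd' ⟨c, h1⟩ ⟨d, h2⟩
    exact Int.isUnit_iff.mp this

theorem isPositiveCompletion {v v' : ℂ} (h : IsLatticeBasis L v v') (hpos : 0 < planeDet v v') :
    IsPositiveCompletion L v v' := by
  refine ⟨?_, h.span_eq, ?_⟩
  · rw [LinearIndependent.pair_iff]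
    intro s t hst
    simp only [zsmul_eq_mul] at hst
    have := eq_zero_of_planeDet_ne_zero h.det_ne_zero (x := s) (y := t) (by push_cast; exact hst)
    exact_mod_cast this
  · rw [im_div_eq_planeDet]
    refine div_pos hpos (Complex.normSq_pos.mpr ?_)
    rintro rfl
    simp [planeDet] at hpos

end IsLatticeBasis

theorem exists_isLatticeBasis (L : Submodule ℤ ℂ) [DiscreteTopology L] [IsZLattice ℝ L] :
    ∃ u w : ℂ, IsLatticeBasis L u w := by
  have : Module.Free ℤ L := ZLattice.module_free ℝ L
  have : Module.Finite ℤ L := ZLattice.module_finite ℝ L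
  have hr : Module.finrank ℤ L = 2 := by rw [ZLattice.rank ℝ L, Complex.finrank_real_complex]
  let b := (Module.finBasis ℤ L).reindex (finCongr hr)
  have hb : LinearIndependent ℝ ![((b 0 : L) : ℂ), ((b 1 : L) : ℂ)] := by
    convert! (b.ofZLatticeBasis ℝ L).linearIndependent using 1
    ext i
    fin_cases i <;> simp
  refine ⟨b 0, b 1, ?_, ?_⟩
  · generalize ((b 0 : L) : ℂ) = u at hb
    generalize ((b 1 : L) : ℂ) = w at hb
    intro hdet
    rw [LinearIndependent.pair_iff] at hb
    unfold planeDet at hdet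
    -- A zero determinant gives w.im • u = u.im • w and w.re • u = u.re • w, so independence forces
    -- w = 0.
    have h1 := hb w.im (-u.im) (by apply Complex.ext <;> simp <;> linarith)
    have h2 := hb w.re (-u.re) (by apply Complex.ext <;> simp <;> linarith)
    have hw : w = 0 := Complex.ext h2.1 h1.1
    have := hb 0 1 (by simp [hw])
    exact one_ne_zero this.2
  · refine Eq.trans ?_ (b.ofZLatticeBasis_span ℝ)
    congr 1
    ext x
    simp [Fin.exists_fin_two, eq_comm]

theorem IsPositiveCompletion.isLatticeBasis {L : Submodule ℤ ℂ} {v v' : ℂ}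
    (h : IsPositiveCompletion L v v') : IsLatticeBasis L v v' ∧ 0 < planeDet v v' := by
  have h3 := h.2.2
  rw [im_div_eq_planeDet] at h3
  have hpos : 0 < planeDet v v' := by
    rcases (Complex.normSq_nonneg v).eq_or_lt with h0 | h0
    · rw [← h0, div_zero] at h3
      exact absurd h3 (lt_irrefl _)
    · exact (div_pos_iff_of_pos_right h0).mp h3
  exact ⟨⟨hpos.ne', h.2.1⟩, hpos⟩

/-- Modulo v, each completion is an integer multiple of the other, so the factor is ±1, and the
common orientation selects 1. This makes the skewness independent of the completion modulo one. -/
theorem IsPositiveCompletion.exists_eq_add {L : Submodule ℤ ℂ} {v v' v'' : ℂ}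
    (h : IsPositiveCompletion L v v') (h' : IsPositiveCompletion L v v'') :
    ∃ n : ℤ, v'' = v' + n * v := by
  obtain ⟨hb, hpos⟩ := h.isLatticeBasis
  obtain ⟨hb', hpos'⟩ := h'.isLatticeBasis
  obtain ⟨n, y, hn⟩ := hb.mem_iff.mp (hb'.mem_iff.mpr ⟨0, 1, (by simp : v'' = _)⟩)
  obtain ⟨m, z, hm⟩ := hb'.mem_iff.mp (hb.mem_iff.mpr ⟨0, 1, (by simp : v' = _)⟩)
  have hyz : 1 = z * y := by
    refine (int_coords_unique hb.det_ne_zero (a := 0) (a' := m + z * n) ?_).2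
    push_cast
    linear_combination hm + z * hn
  have hy : 0 < y := by
    have h1 := planeDet_comb v v' 1 0 n y
    rw [← hn] at h1
    simp only [Int.cast_one, one_mul, Int.cast_zero, zero_mul, add_zero, sub_zero] at h1
    rw [h1] at hpos'
    exact_mod_cast (pos_iff_pos_of_mul_pos hpos').mpr hpos
  have hy1 : y = 1 := by
    have := Int.isUnit_iff.mp (IsUnit.of_mul_eq_one_right z hyz.symm)
    omega
  refine ⟨n, ?_⟩
  rw [hn, hy1]
  push_cast
  ring

theorem skewness_eq_re_div (v v' : ℂ) : skewness v v' = (v' / v).re := by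
  unfold skewness
  rw [Complex.div_re, ← Complex.normSq_eq_norm_sq, Complex.inner]
  simp
  ring

theorem IsPrimitiveVector.exists_isPositiveCompletion {L : Submodule ℤ ℂ} [DiscreteTopology L]
    [IsZLattice ℝ L] {v : ℂ} (hv : IsPrimitiveVector L v) :
    ∃ v' : ℂ, IsPositiveCompletion L v v' := by
  obtain ⟨u, w, h⟩ := exists_isLatticeBasis L
  obtain ⟨a, b, rfl⟩ := h.mem_iff.mp hv.1
  obtain ⟨d, c, hcd⟩ := (h.isPrimitiveVector_iff a b).mp hv
  -- Bézout coefficients complete `v`; their sign is chosen according to the orientation of `u, w`.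
  rcases lt_or_gt_of_ne h.det_ne_zero with hneg | hpos
  · refine ⟨(c : ℤ) * u + (-d : ℤ) * w, IsLatticeBasis.isPositiveCompletion
      (h.of_comb (Or.inr (by linear_combination -hcd))) ?_⟩
    rw [planeDet_comb]
    have : (a * (-d : ℤ) - b * c : ℝ) = -1 := by
      exact_mod_cast (by linear_combination -hcd : a * (-d) - b * c = -1)
    rw [this]
    linarith
  · refine ⟨(-c : ℤ) * u + (d : ℤ) * w, IsLatticeBasis.isPositiveCompletion
      (h.of_comb (Or.inl (by linear_combination hcd))) ?_⟩
    rw [planeDet_comb]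
    have : (a * d - b * (-c : ℤ) : ℝ) = 1 := by
      exact_mod_cast (by linear_combination hcd : a * d - b * (-c) = 1)
    rw [this]
    linarith

theorem IsPositiveCompletion.leastSkewness_eq {L : Submodule ℤ ℂ} {v v' : ℂ}
    (h : IsPositiveCompletion L v v') : ∃ n : ℤ, leastSkewness L v = (v' / v).re + n := by
  have hex : ∃ v', IsPositiveCompletion L v v' := ⟨v', h⟩
  obtain ⟨n, hn⟩ := h.exists_eq_add hex.choose_spec
  have hv : v ≠ 0 := by
    rintro rfl
    have := h.isLatticeBasis.2
    simp [planeDet] at this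
  unfold leastSkewness
  rw [dif_pos hex, skewness_eq_re_div, toIocMod]
  refine ⟨n - toIocDiv (one_pos : (0 : ℝ) < 1) (-1 / 2) (hex.choose / v).re, ?_⟩
  rw [hn, add_div, mul_div_cancel_right₀ _ hv, Complex.add_re, Complex.intCast_re]
  push_cast
  simp only [zsmul_eq_mul, mul_one]
  ring

theorem leastSkewness_mem_Ioc (L : Submodule ℤ ℂ) (v : ℂ) :
    leastSkewness L v ∈ Set.Ioc (-1 / 2 : ℝ) (1 / 2) := by
  unfold leastSkewness
  split_ifs with h
  · have := toIocMod_mem_Ioc (one_pos : (0 : ℝ) < 1) (-1 / 2) (skewness v h.choose)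
    norm_num at this ⊢
    exact this
  · norm_num

/-! ### Skewness as a modular inverse. -/

/-- In the basis `u, w` the skewness of `A u + B w` is, up to a small error, the inverse of `A`
modulo `B`, divided by `B`. -/
theorem IsLatticeBasis.norm_expTwoPi_leastSkewness_sub_le {L : Submodule ℤ ℂ} {u w : ℂ}
    (h : IsLatticeBasis L u w) (k : ℤ) {A B : ℕ} (hB : 0 < B) (hAB : A.Coprime B) :
    ‖expTwoPi (k * leastSkewness L (A * u + B * w)) -
        invPhase (k * SignType.sign (planeDet u w)) B A‖ ≤
      2 * Real.pi * |(k : ℝ)| * (‖u‖ / (B * ‖A * u + B * w‖)) := by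
  set v : ℂ := A * u + B * w with hv
  obtain ⟨s, hs, hs1⟩ : ∃ s : ℤ, (SignType.sign (planeDet u w) : ℤ) = s ∧
      ((s = 1 ∧ 0 < planeDet u w) ∨ (s = -1 ∧ planeDet u w < 0)) := by
    rcases lt_or_gt_of_ne h.det_ne_zero with hneg | hpos
    · exact ⟨-1, by rw [sign_neg hneg]; rfl, Or.inr ⟨rfl, hneg⟩⟩
    · exact ⟨1, by rw [sign_pos hpos]; rfl, Or.inl ⟨rfl, hpos⟩⟩
  rw [hs]
  have : NeZero B := ⟨hB.ne'⟩
  set D : ℕ := ((A : ZMod B)⁻¹).val with hD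
  obtain ⟨C, hC⟩ : ∃ C : ℤ, (A * D : ℤ) - 1 = B * C := by
    have h1 := ZMod.coe_mul_inv_eq_one A hAB
    have h2 : (((A * D - 1 : ℤ)) : ZMod B) = 0 := by
      push_cast
      rw [hD, ZMod.natCast_zmod_val, h1, sub_self]
    exact (ZMod.intCast_zmod_eq_zero_iff_dvd _ _).mp h2 |>.imp fun _ h => h
  -- The factor `s` makes the completion positively oriented even when `u, w` is not.
  have hdet : (A : ℤ) * (s * D) - (B : ℤ) * (s * C) = s := by linear_combination s * hC
  set v' : ℂ := ((s * C : ℤ) : ℂ) * u + ((s * D : ℤ) : ℂ) * w with hv'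
  have hcomp : IsPositiveCompletion L v v' := by
    have h1 : IsLatticeBasis L (((A : ℤ) : ℂ) * u + ((B : ℤ) : ℂ) * w) v' :=
      h.of_comb (by rw [hdet]; tauto)
    have h2 : 0 < planeDet (((A : ℤ) : ℂ) * u + ((B : ℤ) : ℂ) * w) v' := by
      rw [hv', planeDet_comb]
      have : (((A : ℤ) : ℝ) * ((s * D : ℤ) : ℝ) - ((B : ℤ) : ℝ) * ((s * C : ℤ) : ℝ)) = s := by
        exact_mod_cast hdet
      rw [this]
      rcases hs1 with ⟨rfl, h0⟩ | ⟨rfl, h0⟩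
      · simpa using h0
      · simpa using h0
    simp only [Int.cast_natCast] at h1 h2
    exact h1.isPositiveCompletion h2
  obtain ⟨n, hn⟩ := hcomp.leastSkewness_eq
  have hv0 : v ≠ 0 := by
    intro h0
    have := hcomp.isLatticeBasis.2
    rw [h0] at this
    simp [planeDet] at this
  have hB0 : (B : ℂ) ≠ 0 := by exact_mod_cast hB.ne'
  -- The numerator B v' − s D v has no `w` component, and the determinant leaves −s u.
  have hdiv : v' / v - ((s * D / B : ℝ) : ℂ) = -(s * u / (B * v)) := by
    have hdetC : (A : ℂ) * (s * D) - B * (s * C) = s := by exact_mod_cast hdet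
    push_cast
    rw [div_sub_div _ _ hv0 hB0, ← neg_div, mul_comm v (B : ℂ)]
    congr 1
    rw [hv', hv]
    push_cast
    linear_combination -u * hdetC
  have habs : |(v' / v).re - s * D / B| ≤ ‖u‖ / (B * ‖v‖) := by
    have h1 : (v' / v).re - s * D / B = (v' / v - ((s * D / B : ℝ) : ℂ)).re := by
      rw [Complex.sub_re, Complex.ofReal_re]
    rw [h1]
    refine (Complex.abs_re_le_norm _).trans_eq ?_
    have hs' : ‖(s : ℂ)‖ = 1 := by
      rcases hs1 with ⟨rfl, -⟩ | ⟨rfl, -⟩ <;> simp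
    rw [hdiv, norm_neg, norm_div, norm_mul, norm_mul, hs', one_mul, Complex.norm_natCast]
  have he : expTwoPi (k * leastSkewness L v) = expTwoPi (k * (v' / v).re) := by
    rw [hn, mul_add]
    exact_mod_cast expTwoPi_add_intCast _ (k * n)
  rw [he, invPhase, if_pos hAB]
  refine (norm_expTwoPi_sub_le _ _).trans ?_
  rw [mul_assoc (2 * Real.pi)]
  gcongr
  have h2 : (k : ℝ) * (v' / v).re - ((k * s : ℤ) : ℝ) * D / B =
      k * ((v' / v).re - s * D / B) := by
    push_cast
    ring
  rw [h2, abs_mul]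
  gcongr

/-! ### Cones of primitive vectors and bounds for their sums. -/

/-- The vectors `A u + B w` with positive coprime integers `A`, `B`. -/
def primitiveCone (u w : ℂ) : Set ℂ :=
  {v | ∃ A B : ℕ, 0 < A ∧ 0 < B ∧ A.Coprime B ∧ v = A * u + B * w}

/-- The sum of `f` over the vectors of norm at most `T` in a primitive cone. -/
noncomputable def coneSum (f : ℂ → ℂ) (u w : ℂ) (T : ℝ) : ℂ :=
  ∑ᶠ v ∈ primitiveCone u w ∩ Metric.closedBall 0 T, f v

/-- The sum of `f` over a cone is at most `(c + o(1)) T²`. -/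
def ConeBound (f : ℂ → ℂ) (u w : ℂ) (c : ℝ) : Prop :=
  ∀ δ > 0, ∀ᶠ T in atTop, ‖coneSum f u w T‖ ≤ (c + δ) * T ^ 2

theorem ConeBound.mono {f : ℂ → ℂ} {u w : ℂ} {c c' : ℝ} (h : ConeBound f u w c) (hc : c ≤ c') :
    ConeBound f u w c' := by
  intro δ hδ
  filter_upwards [h δ hδ] with T hT
  refine hT.trans ?_
  gcongr

theorem primitiveCone_comm (u w : ℂ) : primitiveCone u w = primitiveCone w u := by
  ext v
  constructor <;>
  · rintro ⟨A, B, hA, hB, hAB, rfl⟩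
    exact ⟨B, A, hB, hA, hAB.symm, add_comm _ _⟩

/-- One subtractive step of Euclid's algorithm: compare A with B; equality and coprimality leave
only the mediant. -/
theorem primitiveCone_eq (u w : ℂ) :
    primitiveCone u w = (primitiveCone u (u + w) ∪ primitiveCone (u + w) w) ∪ {u + w} := by
  ext v
  constructor
  · rintro ⟨A, B, hA, hB, hAB, rfl⟩
    rcases lt_trichotomy A B with hlt | rfl | hlt
    · refine Or.inl (Or.inr ⟨A, B - A, hA, by omega, ?_, ?_⟩)
      · rwa [Nat.coprime_sub_self_right hlt.le]
      · rw [Nat.cast_sub hlt.le]; ring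
    · rw [Nat.coprime_self] at hAB
      subst hAB
      exact Or.inr (by simp)
    · refine Or.inl (Or.inl ⟨A - B, B, by omega, hB, ?_, ?_⟩)
      · rwa [Nat.coprime_sub_self_left hlt.le]
      · rw [Nat.cast_sub hlt.le]; ring
  · rintro ((⟨A, B, hA, hB, hAB, rfl⟩ | ⟨A, B, hA, hB, hAB, rfl⟩) | rfl)
    · exact ⟨A + B, B, by omega, hB, by simpa using hAB, by push_cast; ring⟩
    · exact ⟨A, A + B, hA, by omega, by simpa using hAB, by push_cast; ring⟩
    · exact ⟨1, 1, one_pos, one_pos, Nat.coprime_one_right 1, by simp⟩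

theorem ConeBound.symm {f : ℂ → ℂ} {u w : ℂ} {c : ℝ} (h : ConeBound f u w c) :
    ConeBound f w u c := by
  unfold ConeBound coneSum at h ⊢
  rwa [primitiveCone_comm]

namespace IsLatticeBasis

variable {L : Submodule ℤ ℂ} {u w : ℂ}

theorem nat_coords_unique (h : IsLatticeBasis L u w) {a b a' b' : ℕ}
    (hab : (a : ℂ) * u + b * w = a' * u + b' * w) : a = a' ∧ b = b' := by
  have := int_coords_unique h.det_ne_zero (a := a) (b := b) (a' := a') (b' := b')
    (by exact_mod_cast hab)
  exact_mod_cast this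

theorem primitiveCone_subset (h : IsLatticeBasis L u w) {v : ℂ} (hv : v ∈ primitiveCone u w) :
    IsPrimitiveVector L v := by
  obtain ⟨A, B, -, -, hAB, rfl⟩ := hv
  have := (h.isPrimitiveVector_iff A B).mpr (Nat.isCoprime_iff_coprime.mpr hAB)
  simpa using this

theorem finite_cone_inter [DiscreteTopology L] (h : IsLatticeBasis L u w) (T : ℝ) :
    (primitiveCone u w ∩ Metric.closedBall 0 T).Finite :=
  (primitiveVectors_finite L T).subset fun _ hv =>
    ⟨h.primitiveCone_subset hv.1, by simpa using hv.2⟩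

theorem norm_coneSum_le_add [DiscreteTopology L] (h : IsLatticeBasis L u w) {f : ℂ → ℂ}
    (hf : ∀ v, ‖f v‖ ≤ 1) (T : ℝ) :
    ‖coneSum f u w T‖ ≤ ‖coneSum f u (u + w) T‖ + ‖coneSum f (u + w) w T‖ + 1 := by
  have hd1 : Disjoint (primitiveCone u (u + w)) (primitiveCone (u + w) w) := by
    rw [Set.disjoint_left]
    rintro v ⟨A, B, hA, hB, -, rfl⟩ ⟨A', B', hA', hB', -, e⟩
    have := h.nat_coords_unique (a := A + B) (b := B) (a' := A') (b' := A' + B')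
      (by push_cast; linear_combination e)
    omega
  have hd2 : Disjoint (primitiveCone u (u + w) ∪ primitiveCone (u + w) w) {u + w} := by
    rw [Set.disjoint_singleton_right]
    rintro (⟨A, B, hA, hB, -, e⟩ | ⟨A, B, hA, hB, -, e⟩)
    · have := h.nat_coords_unique (a := 1) (b := 1) (a' := A + B) (b' := B)
        (by push_cast; linear_combination e)
      omega
    · have := h.nat_coords_unique (a := 1) (b := 1) (a' := A) (b' := A + B)
        (by push_cast; linear_combination e)
      omega
  have hfin1 := h.add_right.finite_cone_inter T
  have hfin2 := h.add_left.finite_cone_inter T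
  have hfin3 : (({u + w} : Set ℂ) ∩ Metric.closedBall 0 T).Finite :=
    (Set.finite_singleton _).inter_of_left _
  have key : coneSum f u w T = coneSum f u (u + w) T + coneSum f (u + w) w T +
      ∑ᶠ v ∈ ({u + w} : Set ℂ) ∩ Metric.closedBall 0 T, f v := by
    unfold coneSum
    rw [primitiveCone_eq, Set.union_inter_distrib_right, Set.union_inter_distrib_right,
      finsum_mem_union _ (hfin1.union hfin2) hfin3, finsum_mem_union _ hfin1 hfin2]
    · exact hd1.mono Set.inter_subset_left Set.inter_subset_left
    · rw [← Set.union_inter_distrib_right]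
      exact hd2.mono Set.inter_subset_left Set.inter_subset_left
  rw [key]
  refine (norm_add_le _ _).trans (add_le_add (norm_add_le _ _) ?_)
  by_cases hb : u + w ∈ Metric.closedBall (0 : ℂ) T
  · rw [Set.singleton_inter_of_mem hb, finsum_mem_singleton]
    exact hf _
  · rw [Set.singleton_inter_of_notMem hb, finsum_mem_empty, norm_zero]
    exact zero_le_one

theorem coneBound_add [DiscreteTopology L] (h : IsLatticeBasis L u w) {f : ℂ → ℂ}
    (hf : ∀ v, ‖f v‖ ≤ 1) {c₁ c₂ : ℝ} (h₁ : ConeBound f u (u + w) c₁)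
    (h₂ : ConeBound f (u + w) w c₂) : ConeBound f u w (c₁ + c₂) := by
  intro δ hδ
  have h3 : Tendsto (fun T : ℝ => δ / 3 * T ^ 2) atTop atTop :=
    (tendsto_pow_atTop two_ne_zero).const_mul_atTop (by positivity)
  filter_upwards [h₁ (δ / 3) (by positivity), h₂ (δ / 3) (by positivity),
    h3.eventually_ge_atTop 1] with T t1 t2 t3
  refine (h.norm_coneSum_le_add hf T).trans ?_
  linarith

/-- The sum over a cone as a double sum over coordinates. -/
theorem coneSum_eq (h : IsLatticeBasis L u w) (f : ℂ → ℂ) {T X Y : ℝ}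
    (hXY : ∀ A B : ℕ, ‖(A * u + B * w : ℂ)‖ ≤ T → (A : ℝ) ≤ X ∧ (B : ℝ) ≤ Y) :
    coneSum f u w T = ∑ B ∈ Finset.Icc 1 ⌊Y⌋₊,
      ∑ A ∈ (Finset.Icc 1 ⌊X⌋₊).filter fun A : ℕ => ‖(A * u + B * w : ℂ)‖ ≤ T,
        if A.Coprime B then f (A * u + B * w) else 0 := by
  classical
  let P : Finset (ℕ × ℕ) := (Finset.Icc 1 ⌊Y⌋₊ ×ˢ Finset.Icc 1 ⌊X⌋₊).filter
    fun p => ‖(p.2 * u + p.1 * w : ℂ)‖ ≤ T ∧ p.2.Coprime p.1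
  let g : ℕ × ℕ → ℂ := fun p => p.2 * u + p.1 * w
  have hg : Set.InjOn g P := by
    rintro ⟨b, a⟩ - ⟨b', a'⟩ - e
    have := h.nat_coords_unique e
    exact Prod.ext this.2 this.1
  have hset : primitiveCone u w ∩ Metric.closedBall 0 T = g '' P := by
    ext v
    constructor
    · rintro ⟨⟨A, B, hA, hB, hAB, rfl⟩, hT⟩
      rw [mem_closedBall_zero_iff] at hT
      obtain ⟨h1, h2⟩ := hXY A B hT
      refine ⟨(B, A), ?_, rfl⟩
      simp only [P, Finset.coe_filter, Finset.mem_product, Finset.mem_Icc, Set.mem_ofPred_eq]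
      exact ⟨⟨⟨hB, Nat.le_floor h2⟩, ⟨hA, Nat.le_floor h1⟩⟩, hT, hAB⟩
    · rintro ⟨⟨B, A⟩, hP, rfl⟩
      simp only [P, Finset.coe_filter, Finset.mem_product, Finset.mem_Icc, Set.mem_ofPred_eq] at hP
      exact ⟨⟨A, B, hP.1.2.1, hP.1.1.1, hP.2.2, rfl⟩, by simpa using hP.2.1⟩
  unfold coneSum
  rw [hset, finsum_mem_image hg, finsum_mem_coe_finset, Finset.sum_filter, Finset.sum_product]
  refine Finset.sum_congr rfl fun B _ => ?_
  rw [Finset.sum_filter]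
  refine Finset.sum_congr rfl fun A _ => ?_
  simp only [g]
  split_ifs <;> simp_all

variable {ℓ : ℂ →L[ℝ] ℝ}

/-- Since `ℓ` is positive on both generators, neither term of ℓ(v) = A ℓ(u) + B ℓ(w) can exceed ‖ℓ‖
T. -/
theorem coords_le (hu : 0 < ℓ u) (hw : 0 < ℓ w) {T : ℝ} (A B : ℕ)
    (hT : ‖(A * u + B * w : ℂ)‖ ≤ T) : (A : ℝ) ≤ ‖ℓ‖ * T / ℓ u ∧ (B : ℝ) ≤ ‖ℓ‖ * T / ℓ w := by
  have h1 : ℓ (A * u + B * w) = A * ℓ u + B * ℓ w := by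
    rw [map_add, ← nsmul_eq_mul, ← nsmul_eq_mul, map_nsmul, map_nsmul, nsmul_eq_mul, nsmul_eq_mul]
  have h2 : ℓ (A * u + B * w) ≤ ‖ℓ‖ * T :=
    (le_abs_self _).trans ((ℓ.le_opNorm _).trans (by gcongr))
  rw [h1] at h2
  have h3 : 0 ≤ (A : ℝ) * ℓ u := by positivity
  have h4 : 0 ≤ (B : ℝ) * ℓ w := by positivity
  rw [le_div_iff₀ hu, le_div_iff₀ hw]
  constructor <;> linarith

/-- Counts lattice points in the box of `coords_le`; its area dictates the weight 1/(ℓ(u)ℓ(w)) used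
for all cones. -/
theorem coneBound_trivial (h : IsLatticeBasis L u w) (hu : 0 < ℓ u) (hw : 0 < ℓ w)
    {f : ℂ → ℂ} (hf : ∀ v, ‖f v‖ ≤ 1) : ConeBound f u w (‖ℓ‖ ^ 2 / (ℓ u * ℓ w)) := by
  intro δ hδ
  filter_upwards [eventually_ge_atTop 0] with T hT
  set X := ‖ℓ‖ * T / ℓ u with hX
  set Y := ‖ℓ‖ * T / ℓ w with hY
  have hX0 : 0 ≤ X := by positivity
  have hY0 : 0 ≤ Y := by positivity
  rw [h.coneSum_eq f (coords_le hu hw)]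
  have h1 : ∀ B ∈ Finset.Icc 1 ⌊Y⌋₊,
      ‖∑ A ∈ (Finset.Icc 1 ⌊X⌋₊).filter fun A : ℕ => ‖(A * u + B * w : ℂ)‖ ≤ T,
        if A.Coprime B then f (A * u + B * w) else 0‖ ≤ X := by
    intro B _
    refine (norm_sum_le _ _).trans ((Finset.sum_le_sum (g := fun _ => (1 : ℝ)) ?_).trans ?_)
    · intro A _
      split_ifs
      · exact hf _
      · simp
    · rw [Finset.sum_const, nsmul_eq_mul, mul_one]
      refine le_trans ?_ (Nat.floor_le hX0)
      exact_mod_cast (Finset.card_filter_le _ _).trans (by simp)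
  refine (norm_sum_le _ _).trans ((Finset.sum_le_sum h1).trans ?_)
  rw [Finset.sum_const, nsmul_eq_mul, Nat.card_Icc, Nat.add_sub_cancel]
  calc (⌊Y⌋₊ : ℝ) * X ≤ Y * X := by gcongr; exact Nat.floor_le hY0
    _ = ‖ℓ‖ ^ 2 / (ℓ u * ℓ w) * T ^ 2 := by rw [hX, hY]; field_simp
    _ ≤ _ := by gcongr; linarith

/-- A line meets the convex ball in an interval, so for fixed B the sum over A runs over consecutive
integers. -/
theorem ordConnected_filter_norm_le (u z : ℂ) (T : ℝ) (N : ℕ) :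
    (((Finset.Icc 1 N).filter fun A : ℕ => ‖(A * u + z : ℂ)‖ ≤ T : Finset ℕ) :
      Set ℕ).OrdConnected := by
  have hconv : (((LinearMap.toSpanSingleton ℝ ℂ u) ⁻¹' Metric.closedBall (-z) T)).OrdConnected :=
    ((convex_closedBall (-z) T).linear_preimage _).ordConnected
  have hmem : ∀ A : ℕ, (A : ℝ) ∈ (LinearMap.toSpanSingleton ℝ ℂ u) ⁻¹' Metric.closedBall (-z) T ↔
      ‖(A * u + z : ℂ)‖ ≤ T := by
    intro A
    rw [Set.mem_preimage, LinearMap.toSpanSingleton_apply, mem_closedBall_iff_norm, sub_neg_eq_add]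
    simp
  refine ⟨fun a ha b hb c hc => ?_⟩
  simp only [Finset.coe_filter, Finset.mem_Icc, Set.mem_ofPred_eq, ← hmem] at ha hb ⊢
  refine ⟨⟨ha.1.1.trans hc.1, hc.2.trans hb.1.2⟩, hconv.out ha.2 hb.2 ⟨?_, ?_⟩⟩
  · exact_mod_cast hc.1
  · exact_mod_cast hc.2

theorem norm_coneSum_expTwoPi_le (h : IsLatticeBasis L u w) (hu : 0 < ℓ u) (hw : 0 < ℓ w) {k : ℤ}
    (hk : k ≠ 0) {T : ℝ} (hT : 0 ≤ T) :
    ‖coneSum (fun v => expTwoPi (k * leastSkewness L v)) u w T‖ ≤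
      (‖ℓ‖ * T / ℓ w) ^ 2 + ‖ℓ‖ * T / ℓ u *
        ((k : ℝ) ^ 2 + 2 * Real.pi * |(k : ℝ)| * (‖u‖ * ‖ℓ‖ / ℓ w)) *
        (1 + Real.log ⌊‖ℓ‖ * T / ℓ w⌋₊) := by
  have hℓ : 0 < ‖ℓ‖ := by
    rw [norm_pos_iff]
    rintro rfl
    simp at hu
  set s := (SignType.sign (planeDet u w) : ℤ) with hs
  have hs1 : s = 1 ∨ s = -1 := by
    rcases lt_or_gt_of_ne h.det_ne_zero with hneg | hpos
    · right; rw [hs, sign_neg hneg]; rfl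
    · left; rw [hs, sign_pos hpos]; rfl
  have hks : k * s ≠ 0 := by rcases hs1 with e | e <;> simp [e, hk]
  have hks2 : ((k * s : ℤ) : ℝ) ^ 2 = (k : ℝ) ^ 2 := by rcases hs1 with e | e <;> simp [e]
  set X := ‖ℓ‖ * T / ℓ u with hX
  set Y := ‖ℓ‖ * T / ℓ w with hY
  set E := 2 * Real.pi * |(k : ℝ)| * (‖u‖ * ‖ℓ‖ / ℓ w) with hE
  have hX0 : 0 ≤ X := by positivity
  have hY0 : 0 ≤ Y := by positivity
  have hE0 : 0 ≤ E := by have := Real.pi_pos; positivity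
  rw [h.coneSum_eq _ (coords_le hu hw)]
  -- The incomplete period costs B ≤ Y; the full periods and the approximation error cost O(X/B).
  have h1 : ∀ B ∈ Finset.Icc 1 ⌊Y⌋₊,
      ‖∑ A ∈ (Finset.Icc 1 ⌊X⌋₊).filter fun A : ℕ => ‖(A * u + B * w : ℂ)‖ ≤ T,
        if A.Coprime B then expTwoPi (k * leastSkewness L (A * u + B * w)) else 0‖ ≤
      Y + X * ((k : ℝ) ^ 2 + E) * (B : ℝ)⁻¹ := by
    intro B hB
    rw [Finset.mem_Icc] at hB
    have hBY : (B : ℝ) ≤ Y := (Nat.le_floor_iff hY0).mp hB.2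
    have hB0 : 0 < (B : ℝ) := by exact_mod_cast hB.1
    set S := (Finset.Icc 1 ⌊X⌋₊).filter fun A : ℕ => ‖(A * u + B * w : ℂ)‖ ≤ T with hS
    have hSX : ∀ a ∈ S, 1 ≤ a ∧ (a : ℝ) ≤ X := by
      intro a ha
      rw [hS, Finset.mem_filter, Finset.mem_Icc] at ha
      exact ⟨ha.1.1, (Nat.le_floor_iff hX0).mp ha.1.2⟩
    have hmain := norm_sum_ordConnected_periodic_le hB.1 (invPhase_periodic (k * s) B)
      (norm_invPhase_le (k * s) B) (norm_sum_invPhase_le hks hB.1) S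
      (ordConnected_filter_norm_le u _ T _) hX0 hSX
    rw [hks2] at hmain
    -- As B ≥ 1, the norm of v is at least ℓ(w)/‖ℓ‖, so each approximation error is O(1/B).
    have herr : ∀ A ∈ S, ‖(if A.Coprime B then expTwoPi (k * leastSkewness L (A * u + B * w))
        else 0) - invPhase (k * s) B A‖ ≤ E * (B : ℝ)⁻¹ := by
      intro A hA
      split_ifs with hAB
      · refine (h.norm_expTwoPi_leastSkewness_sub_le k hB.1 hAB).trans ?_
        rw [hE, mul_assoc (2 * Real.pi * |(k : ℝ)|)]
        have hpi := Real.pi_pos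
        gcongr
        have h2 := (coords_le hu hw A B le_rfl).2
        rw [le_div_iff₀ hw] at h2
        have h3 : ℓ w ≤ ‖ℓ‖ * ‖(A * u + B * w : ℂ)‖ := by
          refine le_trans ?_ h2
          exact le_mul_of_one_le_left hw.le (by exact_mod_cast hB.1)
        have h4 : 0 < ‖(A * u + B * w : ℂ)‖ := by
          by_contra hcon
          have : ‖(A * u + B * w : ℂ)‖ = 0 := le_antisymm (not_lt.mp hcon) (norm_nonneg _)
          rw [this, mul_zero] at h3
          linarith
        rw [← div_eq_mul_inv, div_div, div_le_div_iff₀ (by positivity) (by positivity)]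
        calc ‖u‖ * (ℓ w * B) ≤ ‖u‖ * (‖ℓ‖ * ‖(A * u + B * w : ℂ)‖ * B) := by gcongr
          _ = _ := by ring
      · rw [invPhase, if_neg hAB, sub_zero, norm_zero]
        positivity
    have hcard : (S.card : ℝ) ≤ X := by
      refine le_trans ?_ (Nat.floor_le hX0)
      exact_mod_cast (Finset.card_filter_le _ _).trans (by simp)
    have hdiff := (norm_sum_le S _).trans (Finset.sum_le_sum herr)
    rw [Finset.sum_sub_distrib, Finset.sum_const, nsmul_eq_mul] at hdiff
    have h5 := norm_le_norm_add_norm_sub'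
      (∑ A ∈ S, if A.Coprime B then expTwoPi (k * leastSkewness L (A * u + B * w)) else 0)
      (∑ A ∈ S, invPhase (k * s) B A)
    have h6 : (S.card : ℝ) * (E * (B : ℝ)⁻¹) ≤ X * (E * (B : ℝ)⁻¹) := by gcongr
    calc _ ≤ (B + X / B * (k : ℝ) ^ 2) + X * (E * (B : ℝ)⁻¹) := by linarith
      _ ≤ _ := by
        rw [div_eq_mul_inv]
        linarith
  refine (norm_sum_le _ _).trans ((Finset.sum_le_sum h1).trans ?_)
  rw [Finset.sum_add_distrib, Finset.sum_const, nsmul_eq_mul, Nat.card_Icc, Nat.add_sub_cancel,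
    ← Finset.mul_sum]
  have hharm := harmonic_le_one_add_log ⌊Y⌋₊
  rw [harmonic_eq_sum_Icc] at hharm
  push_cast at hharm
  have hY2 : (⌊Y⌋₊ : ℝ) * Y ≤ Y ^ 2 := by
    rw [pow_two]
    gcongr
    exact Nat.floor_le hY0
  gcongr

/-- Only the incomplete periods survive at order T². The constant does not involve ℓ(u), which is
what the subdivision exploits. -/
theorem coneBound_expTwoPi (h : IsLatticeBasis L u w) (hu : 0 < ℓ u) (hw : 0 < ℓ w) {k : ℤ}
    (hk : k ≠ 0) :
    ConeBound (fun v => expTwoPi (k * leastSkewness L v)) u w (‖ℓ‖ ^ 2 / ℓ w ^ 2) := by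
  intro δ hδ
  have hℓ : 0 < ‖ℓ‖ := by
    rw [norm_pos_iff]
    rintro rfl
    simp at hu
  set M := ‖ℓ‖ / ℓ u * ((k : ℝ) ^ 2 + 2 * Real.pi * |(k : ℝ)| * (‖u‖ * ‖ℓ‖ / ℓ w)) with hM
  have hM0 : 0 ≤ M := by have := Real.pi_pos; positivity
  have hq : 0 < ‖ℓ‖ / ℓ w := by positivity
  have hlog : Tendsto (fun T : ℝ => M * ((1 + Real.log (‖ℓ‖ / ℓ w * T)) / T)) atTop (𝓝 0) := by
    have h1 : Tendsto (fun T : ℝ => Real.log T / T) atTop (𝓝 0) :=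
      Real.isLittleO_log_id_atTop.tendsto_div_nhds_zero
    have h2 : Tendsto (fun T : ℝ => (1 + Real.log (‖ℓ‖ / ℓ w)) / T) atTop (𝓝 0) :=
      tendsto_const_nhds.div_atTop tendsto_id
    have h3 := (h1.add h2).const_mul M
    rw [add_zero, mul_zero] at h3
    refine h3.congr' ?_
    filter_upwards [eventually_gt_atTop 0] with T hT
    rw [Real.log_mul hq.ne' hT.ne']
    ring
  have hbig : ∀ᶠ T : ℝ in atTop, 1 ≤ ‖ℓ‖ / ℓ w * T :=
    (tendsto_id.const_mul_atTop hq).eventually_ge_atTop 1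
  filter_upwards [hlog.eventually_le_const hδ, eventually_gt_atTop 0, hbig] with T t1 t2 t3
  refine (h.norm_coneSum_expTwoPi_le hu hw hk t2.le).trans ?_
  have h4 : Real.log ⌊‖ℓ‖ * T / ℓ w⌋₊ ≤ Real.log (‖ℓ‖ / ℓ w * T) := by
    have e : ‖ℓ‖ * T / ℓ w = ‖ℓ‖ / ℓ w * T := by ring
    rw [e]
    apply Real.log_le_log
    · exact_mod_cast Nat.floor_pos.mpr t3
    · exact Nat.floor_le (by positivity)
  calc _ ≤ (‖ℓ‖ * T / ℓ w) ^ 2 + M * T * (1 + Real.log (‖ℓ‖ / ℓ w * T)) := by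
        have e : ‖ℓ‖ * T / ℓ u * ((k : ℝ) ^ 2 + 2 * Real.pi * |(k : ℝ)| * (‖u‖ * ‖ℓ‖ / ℓ w)) =
          M * T := by rw [hM]; ring
        rw [e]
        gcongr
    _ = ‖ℓ‖ ^ 2 / ℓ w ^ 2 * T ^ 2 + M * ((1 + Real.log (‖ℓ‖ / ℓ w * T)) / T) * T ^ 2 := by
        field_simp
    _ ≤ ‖ℓ‖ ^ 2 / ℓ w ^ 2 * T ^ 2 + δ * T ^ 2 := by gcongr
    _ = _ := by ring

end IsLatticeBasis

/-! ### Amplification by subdividing cones. -/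

/-- `R` bounds the sum of `f` over every cone on which `ℓ` is positive, relative to the size
`1 / (ℓ u * ℓ w)` of the cone. -/
def UniformConeBound (L : Submodule ℤ ℂ) (ℓ : ℂ →L[ℝ] ℝ) (f : ℂ → ℂ) (R : ℝ) : Prop :=
  ∀ u w : ℂ, IsLatticeBasis L u w → 0 < ℓ u → 0 < ℓ w → ConeBound f u w (R / (ℓ u * ℓ w))

section UniformConeBound

variable {L : Submodule ℤ ℂ} [DiscreteTopology L] {ℓ : ℂ →L[ℝ] ℝ} {f : ℂ → ℂ} {R : ℝ}

/-- The thin cones cut off by the successive mediants have weights 1/((p+q)q) = 1/(pq) − 1/(p(p+q)),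
which telescope. -/
theorem UniformConeBound.coneBound_of_shear (hR : UniformConeBound L ℓ f R)
    (hf : ∀ v, ‖f v‖ ≤ 1) {u : ℂ} (hu : 0 < ℓ u) (n : ℕ) :
    ∀ {w : ℂ}, IsLatticeBasis L u w → 0 < ℓ w → ∀ {c : ℝ}, ConeBound f u (n * u + w) c →
      ConeBound f u w (c + R * (1 / (ℓ u * ℓ w) - 1 / (ℓ u * (n * ℓ u + ℓ w)))) := by
  induction n with
  | zero =>
    intro w _ _ c hc
    simpa using hc
  | succ n ih =>
    intro w h hw c hc
    have hl : ℓ (u + w) = ℓ u + ℓ w := map_add _ _ _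
    have h1 : ConeBound f u (u + w) _ := ih h.add_right (by rw [hl]; positivity) (c := c) (by
      convert! hc using 1
      push_cast
      ring)
    have h2 := hR _ _ h.add_left (by rw [hl]; positivity) hw
    have h3 := h.coneBound_add hf h1 h2
    rw [hl] at h3
    convert! h3 using 1
    push_cast
    field_simp
    ring

/-- Let p = ℓ(u) ≤ q = ℓ(w). The cone of u and nu + w carries the share q/(np+q) ≥ 1/(n+1) of the
weight, and there the constant drops from R to at most C/n, because p/(np+q) ≤ 1/n. Symmetry covers
q ≤ p. -/
theorem UniformConeBound.improve (hR : UniformConeBound L ℓ f R) (hf : ∀ v, ‖f v‖ ≤ 1) {C : ℝ}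
    (hC : ∀ u w : ℂ, IsLatticeBasis L u w → 0 < ℓ u → 0 < ℓ w → ConeBound f u w (C / ℓ w ^ 2))
    {n : ℕ} (hn : 0 < n) (hRC : C / n ≤ R) (hC0 : 0 ≤ C) :
    UniformConeBound L ℓ f ((R * n + C / n) / (n + 1)) := by
  have key : ∀ u w : ℂ, IsLatticeBasis L u w → 0 < ℓ u → ℓ u ≤ ℓ w →
      ConeBound f u w ((R * n + C / n) / (n + 1) / (ℓ u * ℓ w)) := by
    intro u w h hu huw
    have hw : 0 < ℓ w := hu.trans_le huw
    have hn' : (0 : ℝ) < n := by exact_mod_cast hn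
    have hl : ℓ (n * u + w) = n * ℓ u + ℓ w := by
      rw [map_add, ← nsmul_eq_mul, map_nsmul, nsmul_eq_mul]
    have hb : IsLatticeBasis L u (n * u + w) := by
      simpa using h.of_comb (a := 1) (b := 0) (c := n) (d := 1) (by simp)
    have h1 := hC _ _ hb hu (by rw [hl]; positivity)
    refine (hR.coneBound_of_shear hf hu n h hw h1).mono ?_
    rw [hl]
    generalize ℓ u = p at *
    generalize ℓ w = q at *
    rw [div_le_iff₀ hn'] at hRC
    have e : ((R * n + C / n) / (n + 1)) / (p * q) -
        (C / (n * p + q) ^ 2 + R * (1 / (p * q) - 1 / (p * (n * p + q)))) =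
        ((R * n - C) * ((q - p) * (n * p + q)) * n + C * (n + 1) * q ^ 2) /
          (n * (n + 1) * p * q * (n * p + q) ^ 2) := by
      field_simp
      ring
    have h2 : 0 ≤ ((R * n - C) * ((q - p) * (n * p + q)) * n + C * (n + 1) * q ^ 2) /
          (n * (n + 1) * p * q * (n * p + q) ^ 2) := by
      have := sub_nonneg.mpr hRC
      have := sub_nonneg.mpr huw
      positivity
    linarith
  intro u w h hu hw
  rcases le_total (ℓ u) (ℓ w) with huw | huw
  · exact key u w h hu huw
  · rw [mul_comm (ℓ u)]
    exact (key w u h.symm hw huw).symm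

theorem uniformConeBound_zero (hf : ∀ v, ‖f v‖ ≤ 1) {C : ℝ}
    (hC : ∀ u w : ℂ, IsLatticeBasis L u w → 0 < ℓ u → 0 < ℓ w → ConeBound f u w (C / ℓ w ^ 2))
    (hC0 : 0 ≤ C) : UniformConeBound L ℓ f 0 := by
  set V : Set ℝ := {R | 0 ≤ R ∧ UniformConeBound L ℓ f R} with hV
  have hne : V.Nonempty :=
    ⟨‖ℓ‖ ^ 2, by positivity, fun u w h hu hw => h.coneBound_trivial hu hw hf⟩
  have hbdd : BddBelow V := ⟨0, fun R hR => hR.1⟩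
  set ρ := sInf V with hρ
  have hρ0 : 0 ≤ ρ := le_csInf hne fun R hR => hR.1
  -- The infimum is itself admissible: the slack δ in `ConeBound` absorbs the excess of a nearby R.
  have hρV : UniformConeBound L ℓ f ρ := by
    intro u w h hu hw δ hδ
    have hW : 0 < ℓ u * ℓ w := by positivity
    obtain ⟨R, hR, hRlt⟩ := exists_lt_of_csInf_lt hne
      (show sInf V < ρ + δ / 2 * (ℓ u * ℓ w) by rw [← hρ]; linarith [mul_pos (half_pos hδ) hW])
    filter_upwards [hR.2 u w h hu hw (δ / 2) (half_pos hδ)] with T hT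
    refine hT.trans (mul_le_mul_of_nonneg_right ?_ (sq_nonneg T))
    have : R / (ℓ u * ℓ w) ≤ ρ / (ℓ u * ℓ w) + δ / 2 := by
      rw [div_add' _ _ _ hW.ne']
      gcongr
    linarith
  have hle : ∀ n : ℕ, 0 < n → ρ ≤ C / n := by
    intro n hn
    by_contra! hlt
    have hn' : (0 : ℝ) < n := by exact_mod_cast hn
    -- If ρ > C/n, this weighted mean of ρ and C/n lies strictly below the infimum.
    have hmem : (ρ * n + C / n) / (n + 1) ∈ V :=
      ⟨by positivity, hρV.improve hf hC hn hlt.le hC0⟩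
    have h1 := csInf_le hbdd hmem
    rw [← hρ, le_div_iff₀ (by positivity)] at h1
    linarith
  have hlim : Tendsto (fun n : ℕ => C / (n : ℝ)) atTop (𝓝 0) :=
    tendsto_const_div_atTop_nhds_zero_nat C
  have : ρ ≤ 0 := ge_of_tendsto hlim (by
    filter_upwards [eventually_gt_atTop 0] with n hn using hle n hn)
  rwa [le_antisymm this hρ0] at hρV

end UniformConeBound

/-! ### Exponential sums over all primitive vectors, by quadrants. -/

/-- The real linear functional taking the value one at both vectors of a basis of the plane. -/
theorem exists_functional_eq_one {u w : ℂ} (h : planeDet u w ≠ 0) :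
    ∃ ℓ : ℂ →L[ℝ] ℝ, ℓ u = 1 ∧ ℓ w = 1 := by
  refine ⟨((w - u).im / planeDet u w) • Complex.reCLM - ((w - u).re / planeDet u w) • Complex.imCLM,
    ?_, ?_⟩ <;>
  · simp only [_root_.sub_apply, _root_.smul_apply, Complex.reCLM_apply,
      Complex.imCLM_apply, smul_eq_mul, Complex.sub_re, Complex.sub_im]
    rw [div_mul_eq_mul_div, div_mul_eq_mul_div, ← sub_div, div_eq_one_iff_eq h, planeDet]
    ring

namespace IsLatticeBasis

variable {L : Submodule ℤ ℂ} {u w : ℂ}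

theorem coneBound_expTwoPi_zero [DiscreteTopology L] (h : IsLatticeBasis L u w) {k : ℤ}
    (hk : k ≠ 0) : ConeBound (fun v => expTwoPi (k * leastSkewness L v)) u w 0 := by
  obtain ⟨ℓ, hu, hw⟩ := exists_functional_eq_one h.det_ne_zero
  have := uniformConeBound_zero (L := L) (ℓ := ℓ) (fun v => (norm_expTwoPi _).le)
    (fun u w h hu hw => h.coneBound_expTwoPi hu hw hk) (by positivity) u w h (by simp [hu])
    (by simp [hw])
  simpa using this

theorem primitive_eq_union (h : IsLatticeBasis L u w) {v : ℂ} (hv : IsPrimitiveVector L v) :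
    v ∈ (primitiveCone u w ∪ primitiveCone (-u) w) ∪
      (primitiveCone u (-w) ∪ primitiveCone (-u) (-w)) ∨ v ∈ ({u, -u, w, -w} : Set ℂ) := by
  obtain ⟨a, b, rfl⟩ := h.mem_iff.mp hv.1
  have hc := (h.isPrimitiveVector_iff a b).mp hv
  have hcop : a.natAbs.Coprime b.natAbs := Int.isCoprime_iff_gcd_eq_one.mp hc
  rcases eq_or_ne a 0 with rfl | ha
  · right
    rcases Int.isUnit_iff.mp (isCoprime_zero_left.mp hc) with rfl | rfl <;> simp
  rcases eq_or_ne b 0 with rfl | hb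
  · right
    rcases Int.isUnit_iff.mp (isCoprime_zero_right.mp hc) with rfl | rfl <;> simp
  left
  have hA : 0 < a.natAbs := Int.natAbs_pos.mpr ha
  have hB : 0 < b.natAbs := Int.natAbs_pos.mpr hb
  rcases Int.natAbs_eq a with ea | ea <;> rcases Int.natAbs_eq b with eb | eb <;>
    generalize a.natAbs = A at * <;> generalize b.natAbs = B at * <;> subst ea eb
  · exact Or.inl (Or.inl ⟨A, B, hA, hB, hcop, by simp⟩)
  · exact Or.inr (Or.inl ⟨A, B, hA, hB, hcop, by simp⟩)
  · exact Or.inl (Or.inr ⟨A, B, hA, hB, hcop, by simp⟩)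
  · exact Or.inr (Or.inr ⟨A, B, hA, hB, hcop, by simp⟩)

end IsLatticeBasis

namespace IsLatticeBasis

variable {L : Submodule ℤ ℂ} {u w : ℂ}

theorem primitiveVectors_eq (h : IsLatticeBasis L u w) (T : ℝ) :
    primitiveVectors L T = (((primitiveCone u w ∪ primitiveCone (-u) w) ∪
      (primitiveCone u (-w) ∪ primitiveCone (-u) (-w))) ∪ {u, -u, w, -w}) ∩
        Metric.closedBall 0 T := by
  have h1 : ∀ a b : ℤ, IsCoprime a b → IsPrimitiveVector L (a * u + b * w) := fun a b =>
    (h.isPrimitiveVector_iff a b).mpr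
  ext v
  constructor
  · rintro ⟨hv, hT⟩
    exact ⟨h.primitive_eq_union hv, by simpa using hT⟩
  · rintro ⟨hv, hT⟩
    refine ⟨?_, by simpa using hT⟩
    rcases hv with ((hv | hv) | (hv | hv)) | (rfl | rfl | rfl | rfl)
    · exact h.primitiveCone_subset hv
    · exact h.neg_left.primitiveCone_subset hv
    · exact h.symm.neg_left.symm.primitiveCone_subset hv
    · exact h.neg_left.symm.neg_left.symm.primitiveCone_subset hv
    · simpa using h1 1 0 isCoprime_one_left
    · simpa using h1 (-1) 0 isCoprime_one_left.neg_left
    · simpa using h1 0 1 isCoprime_one_right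
    · simpa using h1 0 (-1) isCoprime_one_right.neg_right

theorem disjoint_cones (h : IsLatticeBasis L u w) :
    Disjoint (primitiveCone u w) (primitiveCone (-u) w) := by
  rw [Set.disjoint_left]
  rintro v ⟨A, B, hA, hB, -, rfl⟩ ⟨A', B', hA', hB', -, e⟩
  have := int_coords_unique h.det_ne_zero (a := A) (b := B) (a' := -A') (b' := B')
    (by push_cast; linear_combination e)
  omega

theorem disjoint_halves (h : IsLatticeBasis L u w) :
    Disjoint (primitiveCone u w ∪ primitiveCone (-u) w)
      (primitiveCone u (-w) ∪ primitiveCone (-u) (-w)) := by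
  rw [Set.disjoint_left]
  rintro v (⟨A, B, hA, hB, -, rfl⟩ | ⟨A, B, hA, hB, -, rfl⟩)
    (⟨A', B', hA', hB', -, e⟩ | ⟨A', B', hA', hB', -, e⟩)
  · have := int_coords_unique h.det_ne_zero (a := A) (b := B) (a' := A') (b' := -B')
      (by push_cast; linear_combination e)
    omega
  · have := int_coords_unique h.det_ne_zero (a := A) (b := B) (a' := -A') (b' := -B')
      (by push_cast; linear_combination e)
    omega
  · have := int_coords_unique h.det_ne_zero (a := -A) (b := B) (a' := A') (b' := -B')
      (by push_cast; linear_combination e)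
    omega
  · have := int_coords_unique h.det_ne_zero (a := -A) (b := B) (a' := -A') (b' := -B')
      (by push_cast; linear_combination e)
    omega

theorem disjoint_axes (h : IsLatticeBasis L u w) :
    Disjoint ((primitiveCone u w ∪ primitiveCone (-u) w) ∪
      (primitiveCone u (-w) ∪ primitiveCone (-u) (-w))) {u, -u, w, -w} := by
  have hcone : ∀ v ∈ (primitiveCone u w ∪ primitiveCone (-u) w) ∪
      (primitiveCone u (-w) ∪ primitiveCone (-u) (-w)),
      ∃ a b : ℤ, a ≠ 0 ∧ b ≠ 0 ∧ v = a * u + b * w := by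
    rintro v ((⟨A, B, hA, hB, -, rfl⟩ | ⟨A, B, hA, hB, -, rfl⟩) |
      (⟨A, B, hA, hB, -, rfl⟩ | ⟨A, B, hA, hB, -, rfl⟩))
    · exact ⟨A, B, by omega, by omega, by push_cast; ring⟩
    · exact ⟨-A, B, by omega, by omega, by push_cast; ring⟩
    · exact ⟨A, -B, by omega, by omega, by push_cast; ring⟩
    · exact ⟨-A, -B, by omega, by omega, by push_cast; ring⟩
  rw [Set.disjoint_left]
  intro v hv hv'
  obtain ⟨a, b, ha, hb, rfl⟩ := hcone v hv
  rcases hv' with e | e | e | e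
  · exact hb (int_coords_unique h.det_ne_zero (a' := 1) (b' := 0) (by simpa using e)).2
  · exact hb (int_coords_unique h.det_ne_zero (a' := -1) (b' := 0) (by simpa using e)).2
  · exact ha (int_coords_unique h.det_ne_zero (a' := 0) (b' := 1) (by simpa using e)).1
  · exact ha (int_coords_unique h.det_ne_zero (a' := 0) (b' := -1) (by simpa using e)).1

theorem norm_sum_primitiveVectors_le [DiscreteTopology L] (h : IsLatticeBasis L u w) {f : ℂ → ℂ}
    (hf : ∀ v, ‖f v‖ ≤ 1) (T : ℝ) :
    ‖∑ v ∈ (primitiveVectors_finite L T).toFinset, f v‖ ≤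
      ‖coneSum f u w T‖ + ‖coneSum f (-u) w T‖ + (‖coneSum f u (-w) T‖ +
        ‖coneSum f (-u) (-w) T‖) + 4 := by
  classical
  have hm := h.symm.neg_left.symm
  have f1 := h.finite_cone_inter T
  have f2 := h.neg_left.finite_cone_inter T
  have f3 := hm.finite_cone_inter T
  have f4 := hm.neg_left.finite_cone_inter T
  have hfin4 : (({u, -u, w, -w} : Set ℂ) ∩ Metric.closedBall 0 T).Finite :=
    Set.Finite.inter_of_left (by simp) _
  have key : ∑ v ∈ (primitiveVectors_finite L T).toFinset, f v =
      coneSum f u w T + coneSum f (-u) w T + (coneSum f u (-w) T + coneSum f (-u) (-w) T) +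
        ∑ᶠ v ∈ ({u, -u, w, -w} : Set ℂ) ∩ Metric.closedBall 0 T, f v := by
    rw [← finsum_mem_eq_finite_toFinset_sum, h.primitiveVectors_eq]
    unfold coneSum
    have d1 := h.disjoint_cones
    have d2 := hm.disjoint_cones
    have d3 := h.disjoint_halves
    have d4 := h.disjoint_axes
    rw [Set.union_inter_distrib_right, finsum_mem_union
        (d4.mono Set.inter_subset_left Set.inter_subset_left) _ hfin4,
      Set.union_inter_distrib_right, finsum_mem_union
        (d3.mono Set.inter_subset_left Set.inter_subset_left),
      Set.union_inter_distrib_right, finsum_mem_union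
        (d1.mono Set.inter_subset_left Set.inter_subset_left) f1 f2,
      Set.union_inter_distrib_right, finsum_mem_union
        (d2.mono Set.inter_subset_left Set.inter_subset_left) f3 f4]
    · rw [Set.union_inter_distrib_right]; exact f1.union f2
    · rw [Set.union_inter_distrib_right]; exact f3.union f4
    · simp only [Set.union_inter_distrib_right]; exact (f1.union f2).union (f3.union f4)
  have hax : ‖∑ᶠ v ∈ ({u, -u, w, -w} : Set ℂ) ∩ Metric.closedBall 0 T, f v‖ ≤ 4 := by
    rw [finsum_mem_eq_finite_toFinset_sum _ hfin4]
    refine (norm_sum_le _ _).trans ((Finset.sum_le_sum fun v _ => hf v).trans ?_)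
    rw [Finset.sum_const, nsmul_eq_mul, mul_one]
    have hsub : hfin4.toFinset ⊆ {u, -u, w, -w} := by
      intro v hv
      rw [Set.Finite.mem_toFinset] at hv
      simpa using hv.1
    exact_mod_cast (Finset.card_le_card hsub).trans Finset.card_le_four
  rw [key]
  exact (norm_add_le _ _).trans (add_le_add ((norm_add_le _ _).trans
    (add_le_add (norm_add_le _ _) (norm_add_le _ _))) hax)

theorem sum_expTwoPi_le [DiscreteTopology L] (h : IsLatticeBasis L u w) {k : ℤ} (hk : k ≠ 0) :
    ∀ δ > 0, ∀ᶠ T in atTop, ‖∑ v ∈ (primitiveVectors_finite L T).toFinset,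
      expTwoPi (k * leastSkewness L v)‖ ≤ δ * T ^ 2 := by
  intro δ hδ
  have hm := h.symm.neg_left.symm
  have h5 : Tendsto (fun T : ℝ => δ / 5 * T ^ 2) atTop atTop :=
    (tendsto_pow_atTop two_ne_zero).const_mul_atTop (by positivity)
  have hδ5 : 0 < δ / 5 := by positivity
  filter_upwards [h.coneBound_expTwoPi_zero hk _ hδ5, h.neg_left.coneBound_expTwoPi_zero hk _ hδ5,
    hm.coneBound_expTwoPi_zero hk _ hδ5, hm.neg_left.coneBound_expTwoPi_zero hk _ hδ5,
    h5.eventually_ge_atTop 4] with T t1 t2 t3 t4 t5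
  refine (h.norm_sum_primitiveVectors_le (fun v => (norm_expTwoPi _).le) T).trans ?_
  linarith

end IsLatticeBasis

/-! ### A quadratic lower bound for the number of primitive vectors. -/

theorem sum_Icc_two_inv_sq_le (n : ℕ) : ∑ d ∈ Finset.Icc 2 n, ((d : ℝ) ^ 2)⁻¹ ≤ 3 / 4 := by
  rcases lt_or_ge n 2 with hn | hn
  · rw [Finset.Icc_eq_empty (by omega)]
    norm_num
  -- The term −1/n makes the induction telescope, with equality at n = 2.
  · have key : ∑ d ∈ Finset.Icc 2 n, ((d : ℝ) ^ 2)⁻¹ ≤ 3 / 4 - (n : ℝ)⁻¹ := by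
      induction n, hn using Nat.le_induction with
      | base => norm_num
      | succ n hn ih =>
        rw [Finset.sum_Icc_succ_top (by omega)]
        have hn0 : (0 : ℝ) < n := by exact_mod_cast (by omega : 0 < n)
        have h1 : (((n + 1 : ℕ) : ℝ) ^ 2)⁻¹ ≤ (n : ℝ)⁻¹ - ((n + 1 : ℕ) : ℝ)⁻¹ := by
          push_cast
          rw [inv_sub_inv hn0.ne' (by positivity), inv_eq_one_div,
            div_le_div_iff₀ (by positivity) (by positivity)]
          nlinarith
        linarith
    have : 0 ≤ (n : ℝ)⁻¹ := by positivity
    linarith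

/-- At least a quarter of the pairs of integers in a square are coprime. -/
theorem sq_le_card_coprime_pairs (X : ℕ) :
    (X : ℝ) ^ 2 / 4 ≤
      ((Finset.Ioc 0 X ×ˢ Finset.Ioc 0 X).filter fun p => p.1.Coprime p.2).card := by
  classical
  set P := Finset.Ioc 0 X ×ˢ Finset.Ioc 0 X with hP
  have hcard : P.card = X ^ 2 := by simp [hP, pow_two]
  -- Union bound: a pair that is not coprime is divisible by its gcd, which lies in [2, X].
  have hsub : (P.filter fun p => ¬ p.1.Coprime p.2) ⊆ (Finset.Icc 2 X).biUnion fun d =>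
      (Finset.Ioc 0 X).filter (d ∣ ·) ×ˢ (Finset.Ioc 0 X).filter (d ∣ ·) := by
    rintro ⟨a, b⟩ hab
    simp only [hP, Finset.mem_filter, Finset.mem_product, Finset.mem_Ioc] at hab
    obtain ⟨⟨ha, hb⟩, hc⟩ := hab
    simp only [Finset.mem_biUnion, Finset.mem_Icc, Finset.mem_product, Finset.mem_filter,
      Finset.mem_Ioc]
    have h1 : 0 < a.gcd b := Nat.gcd_pos_of_pos_left _ ha.1
    have h2 : a.gcd b ≤ a := Nat.gcd_le_left _ ha.1
    have h3 : a.gcd b ≠ 1 := hc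
    exact ⟨a.gcd b, ⟨by omega, by omega⟩, ⟨ha, Nat.gcd_dvd_left _ _⟩, hb, Nat.gcd_dvd_right _ _⟩
  have hbad : ((P.filter fun p => ¬ p.1.Coprime p.2).card : ℝ) ≤ 3 / 4 * (X : ℝ) ^ 2 := by
    calc ((P.filter fun p => ¬ p.1.Coprime p.2).card : ℝ)
        ≤ ∑ d ∈ Finset.Icc 2 X, (((X / d) * (X / d) : ℕ) : ℝ) := by
          have := (Finset.card_le_card hsub).trans Finset.card_biUnion_le
          simp only [Finset.card_product, Nat.Ioc_filter_dvd_card_eq_div] at this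
          exact_mod_cast this
      _ ≤ ∑ d ∈ Finset.Icc 2 X, (X : ℝ) ^ 2 * ((d : ℝ) ^ 2)⁻¹ := by
          refine Finset.sum_le_sum fun d _ => ?_
          push_cast
          rw [← inv_pow, ← mul_pow, ← div_eq_mul_inv, ← pow_two]
          gcongr
          exact Nat.cast_div_le
      _ ≤ _ := by
          rw [← Finset.mul_sum, mul_comm]
          gcongr
          exact sum_Icc_two_inv_sq_le X
  have hsum := Finset.card_filter_add_card_filter_not (s := P) (fun p => p.1.Coprime p.2)
  rw [hcard] at hsum
  have : ((P.filter fun p => p.1.Coprime p.2).card : ℝ) +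
      (P.filter fun p => ¬ p.1.Coprime p.2).card = (X : ℝ) ^ 2 := by exact_mod_cast hsum
  linarith

theorem exists_sq_le_ncard_primitiveVectors (L : Submodule ℤ ℂ) [DiscreteTopology L]
    [IsZLattice ℝ L] :
    ∃ c > 0, ∀ᶠ T : ℝ in atTop, c * T ^ 2 ≤ (primitiveVectors_finite L T).toFinset.card := by
  classical
  obtain ⟨u, w, h⟩ := exists_isLatticeBasis L
  have hu : u ≠ 0 := by
    rintro rfl
    exact h.det_ne_zero (by simp [planeDet])
  set M := ‖u‖ + ‖w‖ with hM
  have hM0 : 0 < M := add_pos_of_pos_of_nonneg (norm_pos_iff.mpr hu) (norm_nonneg _)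
  refine ⟨1 / (16 * M ^ 2), by positivity, ?_⟩
  filter_upwards [eventually_ge_atTop (2 * M)] with T hT
  have hT0 : 0 ≤ T := by linarith
  set X := ⌊T / M⌋₊ with hX
  have hX1 : (X : ℝ) ≤ T / M := Nat.floor_le (by positivity)
  -- For T ≥ 2M the floor loses at most half of T/M; with the coprime density 1/4 this gives the
  -- constant 1/(16M²).
  have hX2 : T / (2 * M) ≤ X := by
    have h1 := Nat.lt_floor_add_one (T / M)
    have h2 : 1 ≤ T / (2 * M) := (one_le_div (by positivity)).mpr hT
    have h3 : T / M = 2 * (T / (2 * M)) := by field_simp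
    rw [← hX] at h1
    linarith
  have hinj : ((Finset.Ioc 0 X ×ˢ Finset.Ioc 0 X).filter fun p => p.1.Coprime p.2).card ≤
      (primitiveVectors_finite L T).toFinset.card := by
    refine Finset.card_le_card_of_injOn (fun p => (p.1 * u + p.2 * w : ℂ)) ?_ ?_
    · rintro ⟨a, b⟩ hab
      simp only [Finset.coe_filter, Finset.mem_product, Finset.mem_Ioc, Set.mem_ofPred_eq] at hab
      obtain ⟨⟨ha, hb⟩, hc⟩ := hab
      rw [Set.Finite.coe_toFinset]
      refine ⟨h.primitiveCone_subset ⟨a, b, ha.1, hb.1, hc, rfl⟩, ?_⟩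
      have ha' : (a : ℝ) ≤ X := by exact_mod_cast ha.2
      have hb' : (b : ℝ) ≤ X := by exact_mod_cast hb.2
      calc ‖(a * u + b * w : ℂ)‖ ≤ a * ‖u‖ + b * ‖w‖ := by
            refine (norm_add_le _ _).trans_eq ?_
            simp
        _ ≤ X * ‖u‖ + X * ‖w‖ := by gcongr
        _ = X * M := by rw [hM]; ring
        _ ≤ T := by rwa [le_div_iff₀ hM0] at hX1
    · rintro ⟨a, b⟩ - ⟨a', b'⟩ - e
      have := h.nat_coords_unique e
      exact Prod.ext this.1 this.2
  calc 1 / (16 * M ^ 2) * T ^ 2 = (T / (2 * M)) ^ 2 / 4 := by field_simp; ring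
    _ ≤ (X : ℝ) ^ 2 / 4 := by gcongr
    _ ≤ _ := (sq_le_card_coprime_pairs X).trans (by exact_mod_cast hinj)

/-! ### Weyl's criterion and frequencies in arcs. -/

/-- The exponential averages of the least skewness tend to zero. -/
theorem tendsto_average_fourier_leastSkewness (L : Submodule ℤ ℂ) [DiscreteTopology L]
    [IsZLattice ℝ L] {k : ℤ} (hk : k ≠ 0) :
    Tendsto (fun T : ℝ => (∑ v ∈ (primitiveVectors_finite L T).toFinset,
        fourier k (leastSkewness L v : UnitAddCircle)) /
      ((primitiveVectors_finite L T).toFinset.card : ℂ)) atTop (𝓝 0) := by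
  obtain ⟨u, w, h⟩ := exists_isLatticeBasis L
  obtain ⟨c, hc, hcT⟩ := exists_sq_le_ncard_primitiveVectors L
  rw [Metric.tendsto_nhds]
  intro ε hε
  filter_upwards [hcT, h.sum_expTwoPi_le hk (c * ε / 2) (by positivity), eventually_gt_atTop 0]
    with T t1 t2 t3
  have hpos : 0 < c * T ^ 2 := by positivity
  have hN := hpos.trans_le t1
  simp_rw [fourier_coe_eq_expTwoPi]
  rw [dist_zero_right, norm_div, Complex.norm_natCast, div_lt_iff₀ hN]
  calc _ ≤ c * ε / 2 * T ^ 2 := t2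
    _ = ε / 2 * (c * T ^ 2) := by ring
    _ < ε * (c * T ^ 2) := by gcongr; linarith
    _ ≤ _ := by gcongr

open MeasureTheory in
theorem integral_fourier_unitAddCircle {k : ℤ} (hk : k ≠ 0) :
    ∫ x : UnitAddCircle, (fourier k x : ℂ) = 0 := by
  have h := congrFun (fourierCoeff_fourier (T := 1) k) 0
  rw [fourierCoeff, Pi.single_eq_of_ne hk.symm] at h
  rw [AddCircle.volume_eq_smul_haarAddCircle]
  simpa using h

/-- Weyl's criterion for continuous test functions. -/
theorem tendsto_average_of_fourier {ι α : Type*} {l : Filter ι} {S : ι → Finset α}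
    {x : α → UnitAddCircle} (hne : ∀ᶠ i in l, (S i).Nonempty)
    (h : ∀ k : ℤ, k ≠ 0 →
      Tendsto (fun i => (∑ a ∈ S i, fourier k (x a)) / ((S i).card : ℂ)) l (𝓝 0))
    (g : C(UnitAddCircle, ℂ)) :
    Tendsto (fun i => (∑ a ∈ S i, g (x a)) / ((S i).card : ℂ)) l (𝓝 (∫ y, g y)) := by
  have hint : ∀ g : C(UnitAddCircle, ℂ), MeasureTheory.Integrable g := fun g =>
    g.continuous.integrable_of_hasCompactSupport (HasCompactSupport.of_compactSpace _)
  have hvol : MeasureTheory.volume.real (Set.univ : Set UnitAddCircle) = 1 := by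
    simp [MeasureTheory.Measure.real]
  have hspan : ∀ g ∈ Submodule.span ℂ (Set.range (@fourier 1)),
      Tendsto (fun i => (∑ a ∈ S i, g (x a)) / ((S i).card : ℂ)) l (𝓝 (∫ y, g y)) := by
    intro g hg
    induction hg using Submodule.span_induction with
    | mem g hg =>
      obtain ⟨k, rfl⟩ := hg
      rcases eq_or_ne k 0 with rfl | hk
      · refine tendsto_const_nhds.congr' ?_
        filter_upwards [hne] with i hi
        have : ((S i).card : ℂ) ≠ 0 := by exact_mod_cast hi.card_pos.ne'
        simp [this, hvol]
      · rw [integral_fourier_unitAddCircle hk]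
        exact h k hk
    | zero => simpa using tendsto_const_nhds
    | add f g _ _ hf hg =>
      simp only [ContinuousMap.add_apply, Finset.sum_add_distrib, add_div]
      rw [MeasureTheory.integral_add (hint f) (hint g)]
      exact hf.add hg
    | smul c f _ hf =>
      simp only [ContinuousMap.smul_apply, smul_eq_mul, ← Finset.mul_sum, mul_div_assoc]
      rw [MeasureTheory.integral_const_mul]
      exact hf.const_mul c
  -- Trigonometric polynomials are uniformly dense; replacing `g` by one costs ε/3 in the average
  -- and ε/3 in the integral.
  have hg : g ∈ (Submodule.span ℂ (Set.range (@fourier 1))).topologicalClosure := by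
    rw [span_fourier_closure_eq_top]
    trivial
  rw [Metric.tendsto_nhds]
  intro ε hε
  obtain ⟨f, hf, hfg⟩ := Metric.mem_closure_iff.mp hg (ε / 3) (by positivity)
  filter_upwards [Metric.tendsto_nhds.mp (hspan f hf) (ε / 3) (by positivity), hne] with i hi hSi
  have hN : (0 : ℝ) < (S i).card := by exact_mod_cast hSi.card_pos
  have hpt : ∀ y, ‖g y - f y‖ ≤ ε / 3 := fun y => by
    rw [← dist_eq_norm]
    exact (ContinuousMap.dist_apply_le_dist y).trans hfg.le
  have h1 : dist ((∑ a ∈ S i, g (x a)) / ((S i).card : ℂ))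
      ((∑ a ∈ S i, f (x a)) / ((S i).card : ℂ)) ≤ ε / 3 := by
    rw [dist_eq_norm, ← sub_div, ← Finset.sum_sub_distrib, norm_div, Complex.norm_natCast,
      div_le_iff₀ hN]
    refine (norm_sum_le _ _).trans ((Finset.sum_le_sum fun a _ => hpt (x a)).trans ?_)
    rw [Finset.sum_const, nsmul_eq_mul, mul_comm]
  have h2 : dist (∫ y, f y) (∫ y, g y) ≤ ε / 3 := by
    rw [dist_comm, dist_eq_norm, ← MeasureTheory.integral_sub (hint g) (hint f)]
    refine (MeasureTheory.norm_integral_le_of_norm_le_const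
      (Filter.Eventually.of_forall hpt)).trans_eq ?_
    rw [hvol, mul_one]
  have h3 := dist_triangle4 ((∑ a ∈ S i, g (x a)) / ((S i).card : ℂ))
    ((∑ a ∈ S i, f (x a)) / ((S i).card : ℂ)) (∫ y, f y) (∫ y, g y)
  linarith

open MeasureTheory in
/-- A sequence satisfying Weyl's criterion visits an open set at least as often as expected. -/
theorem eventually_lt_frequency_of_fourier {ι α : Type*} {l : Filter ι} {S : ι → Finset α}
    {x : α → UnitAddCircle} (hne : ∀ᶠ i in l, (S i).Nonempty)
    (h : ∀ k : ℤ, k ≠ 0 →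
      Tendsto (fun i => (∑ a ∈ S i, fourier k (x a)) / ((S i).card : ℂ)) l (𝓝 0))
    {U : Set UnitAddCircle} [DecidablePred fun a => x a ∈ U] (hU : IsOpen U) {c : ℝ}
    (hc : c < volume.real U) :
    ∀ᶠ i in l, c < (((S i).filter fun a => x a ∈ U).card : ℝ) / (S i).card := by
  rcases lt_or_ge c 0 with hc0 | hc0
  · exact Filter.Eventually.of_forall fun i => hc0.trans_le (by positivity)
  -- Inner regularity and Urysohn's lemma give a continuous φ below the indicator of `U` whose
  -- integral still exceeds `c`.
  obtain ⟨K, hKU, hK, hcK⟩ := hU.exists_lt_isCompact (μ := volume) (r := ENNReal.ofReal c)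
    ((ENNReal.ofReal_lt_iff_lt_toReal hc0 (measure_ne_top _ _)).mpr hc)
  have hcK' : c < volume.real K := (ENNReal.ofReal_lt_iff_lt_toReal hc0 (measure_ne_top _ _)).mp hcK
  obtain ⟨φ, hφ0, hφ1, hφ⟩ := exists_continuous_zero_one_of_isClosed hU.isClosed_compl hK.isClosed
    (Set.disjoint_left.mpr fun y hy hyK => hy (hKU hyK))
  let g : C(UnitAddCircle, ℂ) := ⟨fun y => (φ y : ℂ), by fun_prop⟩
  have hg := (Complex.continuous_re.tendsto _).comp (tendsto_average_of_fourier hne h g)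
  have hre : (∫ y, g y).re = ∫ y, φ y := by
    have : ∫ y, g y = ((∫ y, φ y : ℝ) : ℂ) := integral_ofReal
    rw [this, Complex.ofReal_re]
  rw [hre] at hg
  have hint : Integrable φ volume :=
    φ.continuous.integrable_of_hasCompactSupport (HasCompactSupport.of_compactSpace _)
  have hKφ : volume.real K ≤ ∫ y, φ y := by
    rw [← integral_indicator_one hK.measurableSet]
    refine integral_mono ((integrable_const (1 : ℝ)).indicator hK.measurableSet) hint fun y => ?_
    by_cases hy : y ∈ K
    · rw [Set.indicator_of_mem hy, hφ1 hy]
    · rw [Set.indicator_of_notMem hy]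
      exact (hφ y).1
  filter_upwards [hg.eventually_const_lt (hcK'.trans_le hKφ)] with i hi
  refine hi.trans_le ?_
  have hre2 : ((∑ a ∈ S i, g (x a)) / ((S i).card : ℂ)).re = (∑ a ∈ S i, φ (x a)) / (S i).card := by
    have : (∑ a ∈ S i, g (x a)) / ((S i).card : ℂ) =
        (((∑ a ∈ S i, φ (x a)) / (S i).card : ℝ) : ℂ) := by
      push_cast
      rfl
    rw [this, Complex.ofReal_re]
  simp only [Function.comp_apply]
  rw [hre2]
  gcongr
  rw [Finset.card_filter]
  push_cast
  refine Finset.sum_le_sum fun a _ => ?_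
  split_ifs with ha
  · exact (hφ _).2
  · exact (hφ0 ha).le

open MeasureTheory in
theorem volume_coe_image_Ioo {a b : ℝ} (hb : b ≤ a + 1) :
    volume ((fun y : ℝ => (y : UnitAddCircle)) '' Set.Ioo a b) = ENNReal.ofReal (b - a) := by
  have hopen : IsOpen ((fun y : ℝ => (y : UnitAddCircle)) '' Set.Ioo a b) :=
    QuotientAddGroup.isOpenMap_coe _ isOpen_Ioo
  rw [← (UnitAddCircle.measurePreserving_mk a).measure_preimage
      hopen.measurableSet.nullMeasurableSet,
    Measure.restrict_apply (hopen.measurableSet.preimage AddCircle.measurable_mk')]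
  have : ((fun y : ℝ => (y : UnitAddCircle)) ⁻¹'
      ((fun y : ℝ => (y : UnitAddCircle)) '' Set.Ioo a b)) ∩ Set.Ioc a (a + 1) = Set.Ioo a b := by
    ext y
    constructor
    · rintro ⟨⟨z, hz, hzy⟩, hy⟩
      have : z = y := (AddCircle.coe_eq_coe_iff_of_mem_Ioc ⟨hz.1, hz.2.le.trans hb⟩ hy).mp hzy
      exact this ▸ hz
    · intro hy
      exact ⟨⟨y, hy, rfl⟩, hy.1, hy.2.le.trans hb⟩
  rw [this, Real.volume_Ioo]

/-- The open arc (α, β) gives the lower bound. The disjoint open arc (β, α + 1) has the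
complementary length, so its lower bound is the upper bound for the first; the endpoints need no
separate treatment. -/
theorem tendsto_frequency_leastSkewness (L : Submodule ℤ ℂ) [DiscreteTopology L] [IsZLattice ℝ L]
    {α β : ℝ} (hα : -1 / 2 ≤ α) (hαβ : α ≤ β) (hβ : β ≤ 1 / 2) :
    Tendsto
      (fun T : ℝ =>
        ({v ∈ primitiveVectors L T | α < leastSkewness L v ∧ leastSkewness L v < β}.ncard : ℝ) /
          ((primitiveVectors L T).ncard : ℝ))
      atTop (𝓝 (β - α)) := by
  classical
  set S : ℝ → Finset ℂ := fun T => (primitiveVectors_finite L T).toFinset with hS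
  set x : ℂ → UnitAddCircle := fun v => (leastSkewness L v : UnitAddCircle) with hx
  set U : Set UnitAddCircle := (fun y : ℝ => (y : UnitAddCircle)) '' Set.Ioo α β with hU
  set V : Set UnitAddCircle := (fun y : ℝ => (y : UnitAddCircle)) '' Set.Ioo β (α + 1) with hV
  have hxU : ∀ v, x v ∈ U ↔ α < leastSkewness L v ∧ leastSkewness L v < β := by
    intro v
    have hv := leastSkewness_mem_Ioc L v
    constructor
    · rintro ⟨z, hz, hzv⟩
      have : z = leastSkewness L v := (AddCircle.coe_eq_coe_iff_of_mem_Ioc (a := -1 / 2)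
        ⟨hα.trans_lt hz.1, by linarith [hz.2]⟩ ⟨hv.1, by linarith [hv.2]⟩).mp hzv
      exact this ▸ hz
    · exact fun h => ⟨_, h, rfl⟩
  have hdisj : ∀ v, x v ∈ U → x v ∉ V := by
    rintro v hvU ⟨z, hz, hzv⟩
    have hv := (hxU v).mp hvU
    -- Both points are compared in the window (α, α + 1], which contains the second arc.
    have : z = leastSkewness L v := (AddCircle.coe_eq_coe_iff_of_mem_Ioc (a := α)
      ⟨hαβ.trans_lt hz.1, hz.2.le⟩ ⟨hv.1, by linarith [hv.2]⟩).mp hzv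
    rw [← this] at hv
    exact lt_asymm hv.2 hz.1
  have hUo : IsOpen U := QuotientAddGroup.isOpenMap_coe _ isOpen_Ioo
  have hVo : IsOpen V := QuotientAddGroup.isOpenMap_coe _ isOpen_Ioo
  have hUvol : MeasureTheory.volume.real U = β - α := by
    rw [MeasureTheory.Measure.real, volume_coe_image_Ioo (by linarith),
      ENNReal.toReal_ofReal (by linarith)]
  have hVvol : MeasureTheory.volume.real V = α + 1 - β := by
    rw [MeasureTheory.Measure.real, volume_coe_image_Ioo (by linarith),
      ENNReal.toReal_ofReal (by linarith)]
  have hne : ∀ᶠ T in atTop, (S T).Nonempty := by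
    obtain ⟨c, hc, hcT⟩ := exists_sq_le_ncard_primitiveVectors L
    filter_upwards [hcT, eventually_gt_atTop 0] with T t1 t2
    rw [← Finset.card_pos]
    exact_mod_cast (by positivity : 0 < c * T ^ 2).trans_le t1
  have hfourier : ∀ k : ℤ, k ≠ 0 →
      Tendsto (fun T => (∑ a ∈ S T, fourier k (x a)) / ((S T).card : ℂ)) atTop (𝓝 0) :=
    fun k hk => tendsto_average_fourier_leastSkewness L hk
  have hcard : ∀ T : ℝ,
      ({v ∈ primitiveVectors L T | α < leastSkewness L v ∧ leastSkewness L v < β}.ncard : ℝ) /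
        ((primitiveVectors L T).ncard : ℝ) = ((S T).filter fun v => x v ∈ U).card / (S T).card := by
    intro T
    have h1 : {v ∈ primitiveVectors L T | α < leastSkewness L v ∧ leastSkewness L v < β} =
        ((S T).filter fun v => x v ∈ U : Finset ℂ) := by
      ext v
      simp [hS, hxU]
    rw [h1, Set.ncard_coe_finset, Set.ncard_eq_toFinset_card _ (primitiveVectors_finite L T)]
  simp_rw [hcard]
  refine tendsto_order.mpr ⟨fun c hc => ?_, fun c hc => ?_⟩
  · exact eventually_lt_frequency_of_fourier hne hfourier hUo (hUvol ▸ hc)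
  · have hc' : 1 - c < MeasureTheory.volume.real V := by rw [hVvol]; linarith
    filter_upwards [eventually_lt_frequency_of_fourier hne hfourier hVo hc', hne] with T hT hST
    have hN : (0 : ℝ) < (S T).card := by exact_mod_cast hST.card_pos
    have hsum : ((S T).filter fun v => x v ∈ U).card + ((S T).filter fun v => x v ∈ V).card ≤
        (S T).card := by
      rw [← Finset.card_union_of_disjoint]
      · exact Finset.card_le_card
          (Finset.union_subset (Finset.filter_subset _ _) (Finset.filter_subset _ _))
      · exact Finset.disjoint_filter.mpr fun v _ hv => hdisj v hv
    have hsum' : (((S T).filter fun v => x v ∈ U).card : ℝ) / (S T).card +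
        (((S T).filter fun v => x v ∈ V).card : ℝ) / (S T).card ≤ 1 := by
      rw [← add_div, div_le_one hN]
      exact_mod_cast hsum
    linarith

theorem mainTheorem2 (L : Submodule ℤ ℂ) [DiscreteTopology L] [IsZLattice ℝ L] :
    (∀ v : ℂ, IsPrimitiveVector L v →
      (∃ v' : ℂ, IsPositiveCompletion L v v') ∧
      leastSkewness L v ∈ Set.Ioc (-1 / 2 : ℝ) (1 / 2) ∧
      ∀ v' : ℂ, IsPositiveCompletion L v v' →
        skewness v v' = (v' / v).re ∧ ∃ n : ℤ, leastSkewness L v = skewness v v' + n) ∧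
    ∀ α β : ℝ, -1 / 2 ≤ α → α ≤ β → β ≤ 1 / 2 →
      Tendsto
        (fun T : ℝ =>
          ({v ∈ primitiveVectors L T | α < leastSkewness L v ∧ leastSkewness L v < β}.ncard : ℝ) /
            ((primitiveVectors L T).ncard : ℝ))
        atTop (𝓝 (β - α)) := by
  refine ⟨fun v hv => ⟨hv.exists_isPositiveCompletion, leastSkewness_mem_Ioc L v, fun v' hv' => ?_⟩,
    fun α β hα hαβ hβ => tendsto_frequency_leastSkewness L hα hαβ hβ⟩
  rw [skewness_eq_re_div]
  exact ⟨rfl, hv'.leastSkewness_eq⟩
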